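/- Let $n\ge 4$ and $q\ge 2$ be integers, and let $r,s\in(\mathbb Z/q\mathbb Z)^n$ satisfy $\sum_i r_i=\sum_j s_j$. Let $\Omega$ be the (non-empty, finite) set of $n\times n$ matrices with entries in $\mathbb Z/q\mathbb Z$, row sums $r_1,\dots,r_n$ and column sums $s_1,\dots,s_n$. The Diaconis–Gangolli walk on $\Omega$ is the Markov chain which at each step picks two distinct rows $i<j$ and two distinct columns $k<l$ uniformly at random, flips a fair coin, and adds to the entries at the positions $\begin{pmatrix}(i,k)&(i,l)\\(j,k)&(j,l)\end{pmatrix}$ the matrix $T=\begin{pmatrix}-1&1\\1&-1\end{pmatrix}$ (heads) or $-T$ (tails). Let $P^t_A(B)$ be the probability of moving from $A$ to $B$ in $t$ steps, and let $$d(t)=\max_{A\in\Omega}\frac12\sum_{B\in\Omega}\left|P^t_A(B)-\frac1{|\Omega|}\right|,\qquad t\in\{0,1,2,\dots\}.$$ (a) (Upper bound) For every real $c\ge\frac{640}{\log\log(16n)}$ and every $$t\ge\frac{n^2}{4(1-\cos\frac{2\pi}{q})}\log n+\frac{n^2}{1-\cos\frac{2\pi}{q}}\,c\,\log\log(16n)\,\sqrt{\log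 n}\,\log q$$ we have $d(t)\le q^{-c}$. (b) (Lower bound) For every real $c\ge0$ and every $$t\le\frac{n^2}{4(1-\cos\frac{2\pi}{q})}\log n-\frac{n^2}{4(1-\cos\frac{2\pi}{q})}(c+12)\log q$$ we have $d(t)\ge1-q^{-c}$. Consequently the walk has cutoff at time $\frac{n^2}{4(1-\cos\frac{2\pi}{q})}\log n$ when $\log q=o\!\left(\frac{\sqrt{\log n}}{\log\log n}\right)$. Precisely: let $(n_k)$, $(q_k)$ be sequences of integers with $n_k\ge4$, $q_k\ge2$, $n_k\to\infty$ and $\log q_k=o\!\left(\frac{\sqrt{\log n_k}}{\log\log n_k}\right)$; for each $k$ take any row and column sums in $\mathbb Z/q_k\mathbb Z$ with equal totals, let $d_k$ be the corresponding distance function, and put $T_k=\frac{n_k^2}{4(1-\cos\frac{2\pi}{q_k})}\log n_k$. Then for every $\varepsilon\in(0,1)$, $d_k(\lfloor(1-\varepsilon)T_k\rfloor)\to1$ and $d_k(\lceil(1+\varepsilon)T_k\rceil)\to0$ as $k\to\infty$. -/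

import Mathlib

open scoped Topology

/-- `n × n` contingency tables over `ℤ/qℤ` with row sums `row` and column sums `col`. -/
abbrev ContingencyTable (n q : ℕ) (row col : Fin n → ZMod q) : Type :=
  {A : Matrix (Fin n) (Fin n) (ZMod q) //
    (∀ i, ∑ j, A i j = row i) ∧ (∀ j, ∑ i, A i j = col j)}

/-- The choices made in one step: rows `i < j`, columns `k < l`, and the outcome of a coin flip,
encoded as `((i, j), (k, l), coin)`. -/
def dgChoices (n : ℕ) : Finset ((Fin n × Fin n) × (Fin n × Fin n) × Bool) :=
  Finset.univ.filter fun m => m.1.1 < m.1.2 ∧ m.2.1.1 < m.2.1.2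

/-- The `n × n` matrix with the block `(-1, 1; 1, -1)` in the rows `i, j` and columns `k, l`. -/
def dgCorner {n : ℕ} (q : ℕ) (i j k l : Fin n) : Matrix (Fin n) (Fin n) (ZMod q) :=
  Matrix.single i l 1 + Matrix.single j k 1 - Matrix.single i k 1 - Matrix.single j l 1

/-- The matrix that is added to the current table: the corner matrix if the coin shows heads
(`true`), its negative if it shows tails. -/
def dgIncrement {n : ℕ} (q : ℕ) (m : (Fin n × Fin n) × (Fin n × Fin n) × Bool) :
    Matrix (Fin n) (Fin n) (ZMod q) :=
  if m.2.2 then dgCorner q m.1.1 m.1.2 m.2.1.1 m.2.1.2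
  else -dgCorner q m.1.1 m.1.2 m.2.1.1 m.2.1.2

/-- The transition matrix of the Diaconis–Gangolli walk: `P A B` is the probability that a
uniformly random choice leads from `A` to `B`. -/
noncomputable def dgTransition {n q : ℕ} (row col : Fin n → ZMod q) :
    Matrix (ContingencyTable n q row col) (ContingencyTable n q row col) ℝ :=
  Matrix.of fun A B =>
    (((dgChoices n).filter fun m => A.1 + dgIncrement q m = B.1).card : ℝ) / (dgChoices n).card

/-- `d(t)`: the largest total variation distance, over all starting tables `A`, between the law of
the walk after `t` steps and the uniform distribution on the set of contingency tables. -/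
noncomputable def dgDist {n q : ℕ} [NeZero q] (row col : Fin n → ZMod q) (t : ℕ) : ℝ :=
  ⨆ A : ContingencyTable n q row col, (1 / 2 : ℝ) * ∑ B : ContingencyTable n q row col,
    |(dgTransition row col ^ t) A B - 1 / (Fintype.card (ContingencyTable n q row col) : ℝ)|

/-- A sequence of chains with distances to stationarity `d k` has cutoff at the times `T k`. -/
def HasCutoffAt (d : ℕ → ℕ → ℝ) (T : ℕ → ℝ) : Prop :=
  ∀ ε : ℝ, 0 < ε → ε < 1 →
    Filter.Tendsto (fun k => d k ⌊(1 - ε) * T k⌋₊) Filter.atTop (𝓝 1) ∧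
    Filter.Tendsto (fun k => d k ⌈(1 + ε) * T k⌉₊) Filter.atTop (𝓝 0)

/-! The walk is a random walk on a coset of the group of matrices with zero row and column sums, so
the characters `tableChar Y` are eigenfunctions. The eigenvalue of `Y` averages the cosine of the
alternating corner sum of `Y` over rectangles. Matrices `u i + v j` have vanishing corner sums and
give constant characters, so only the class of `Y` modulo these matters. Write `x = 1 - cos (2π /
q)` and `R = rectCount Y`. A nonzero corner sum costs at least `x`, whence `1 - λ ≥ x R / n ^ 4`.

Upper bound. Cauchy–Schwarz and Parseval bound the squared `ℓ¹` distance by the sum of `λ ^ (2 t)`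
over nontrivial classes, each represented by a matrix of minimal weight `w`
(`sq_sum_abs_dgTransition_pow_sub_le`). With `V = 2 t x / n ^ 2` a nonnegative eigenvalue
contributes at most `exp (-V R / n ^ 2)`; negative ones are at least `-1/3` and decay fast enough to
beat the number `q ^ (n ^ 2)` of all matrices. Minimality gives `R ≥ n ^ 2 w`
(`sq_mul_tableWeight_le_rectCount`). If `Y` is sparse, an entry in a row and a column with few
nonzero entries is the only nonzero corner of nearly `n ^ 2` rectangles in each of its four possible
positions, so such entries contribute about `4 n ^ 2` each
(`four_mul_lightWeight_mul_le_rectCount`). At `V ≈ (log n) / 2` this cost `4 V ≈ 2 log n` balances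
the `n ^ 2` places for an entry, which is where the cutoff time comes from.

Entries in heavy rows or columns have only a weaker guaranteed cost, but also less entropy: once the
few heavy lines are chosen, each of their cells has just `q` values. `decay_rate_ge` interpolates
between the two bounds on `R` with `L = √(log n)` and density threshold `1 / L`, and
`sum_exp_lightWeight_heavyWeight_le` counts the matrices by guessing the heavy lines. Matrices of
weight at least `n ^ 2 / L` are paid for by `R ≥ n ^ 2 w` alone, and so is everything when `L ≤ 50`.

Lower bound. The statistic adding the characters of all single cells has mean zero and second moment
`n ^ 2` under the uniform law. After `t` steps its mean is `n ^ 2 μ ^ t` with `μ = 1 - 4 x / n ^ 2`.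
Two cells share few rectangles, so their joint eigenvalue is nearly at most `μ ^ 2` and the variance
is small (`sum_walkEigenvalue_cellTable_sub_le`). Before the cutoff time the mean far exceeds both
standard deviations, and the second moment method separates the laws (`le_dgDist_of_eigenvalues`).
-/

/-- The standard bilinear pairing of matrices. -/
def tablePairing {n q : ℕ} (Y B : Matrix (Fin n) (Fin n) (ZMod q)) : ZMod q :=
  ∑ i, ∑ j, Y i j * B i j

/-- The character of the group of all `n × n` matrices over `ℤ/qℤ` that is indexed by `Y`. -/
noncomputable def tableChar {n q : ℕ} [NeZero q] (Y B : Matrix (Fin n) (Fin n) (ZMod q)) : ℂ :=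
  ZMod.stdAddChar (tablePairing Y B)

/-- The alternating sum of the entries of `Y` at the corners of a rectangle. -/
def rectDiff {n q : ℕ} (Y : Matrix (Fin n) (Fin n) (ZMod q)) (i j k l : Fin n) : ZMod q :=
  Y i l + Y j k - Y i k - Y j l

/-- The eigenvalue of the walk that belongs to the character `tableChar Y`. -/
noncomputable def walkEigenvalue {n q : ℕ} [NeZero q] (Y : Matrix (Fin n) (Fin n) (ZMod q)) : ℝ :=
  (∑ m ∈ dgChoices n, (tableChar Y (dgIncrement q m)).re) / (dgChoices n).card

/-! ### Characters of the matrix group as eigenfunctions of the walk -/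

section Characters

variable {n q : ℕ}

lemma tablePairing_add_right (Y B B' : Matrix (Fin n) (Fin n) (ZMod q)) :
    tablePairing Y (B + B') = tablePairing Y B + tablePairing Y B' := by
  simp [tablePairing, mul_add, Finset.sum_add_distrib]

lemma tablePairing_add_left (Y Y' B : Matrix (Fin n) (Fin n) (ZMod q)) :
    tablePairing (Y + Y') B = tablePairing Y B + tablePairing Y' B := by
  simp [tablePairing, add_mul, Finset.sum_add_distrib]

lemma tablePairing_neg_right (Y B : Matrix (Fin n) (Fin n) (ZMod q)) :
    tablePairing Y (-B) = -tablePairing Y B := by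
  simp [tablePairing]

lemma tablePairing_neg_left (Y B : Matrix (Fin n) (Fin n) (ZMod q)) :
    tablePairing (-Y) B = -tablePairing Y B := by
  simp [tablePairing]

lemma tablePairing_single_left (a b : Fin n) (B : Matrix (Fin n) (Fin n) (ZMod q)) :
    tablePairing (Matrix.single a b 1) B = B a b := by
  simp only [tablePairing, Matrix.single_apply, ite_mul, one_mul, zero_mul, ite_and]
  simp

lemma tablePairing_single_right (a b : Fin n) (Y : Matrix (Fin n) (Fin n) (ZMod q)) :
    tablePairing Y (Matrix.single a b 1) = Y a b := by
  simp only [tablePairing, Matrix.single_apply, mul_ite, mul_one, mul_zero, ite_and]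
  simp

lemma tablePairing_dgCorner (Y : Matrix (Fin n) (Fin n) (ZMod q)) (i j k l : Fin n) :
    tablePairing Y (dgCorner q i j k l) = rectDiff Y i j k l := by
  simp only [dgCorner, sub_eq_add_neg, tablePairing_add_right, tablePairing_neg_right,
    tablePairing_single_right, rectDiff]

lemma dgIncrement_row_sum (m : (Fin n × Fin n) × (Fin n × Fin n) × Bool) (i : Fin n) :
    ∑ j, dgIncrement q m i j = 0 := by
  have h : ∀ a b c d : Fin n, ∑ j, dgCorner q a b c d i j = 0 := by
    intro a b c d
    simp only [dgCorner, Matrix.sub_apply, Matrix.add_apply, Matrix.single_apply, ite_and,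
      Finset.sum_sub_distrib, Finset.sum_add_distrib]
    split_ifs <;> simp
  unfold dgIncrement
  split_ifs <;> simp [h]

lemma dgIncrement_col_sum (m : (Fin n × Fin n) × (Fin n × Fin n) × Bool) (j : Fin n) :
    ∑ i, dgIncrement q m i j = 0 := by
  have h : ∀ a b c d : Fin n, ∑ i, dgCorner q a b c d i j = 0 := by
    intro a b c d
    simp only [dgCorner, Matrix.sub_apply, Matrix.add_apply, Matrix.single_apply, ite_and,
      Finset.sum_sub_distrib, Finset.sum_add_distrib, Finset.sum_ite_eq, Finset.mem_univ, if_true]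
    split_ifs <;> simp_all
  unfold dgIncrement
  split_ifs <;> simp [h]

lemma dgIncrement_not (m : (Fin n × Fin n) × (Fin n × Fin n) × Bool) :
    dgIncrement q (m.1, m.2.1, !m.2.2) = -dgIncrement q m := by
  rcases m with ⟨r, c, b⟩
  cases b <;> simp [dgIncrement]

variable [NeZero q]

lemma tableChar_add_right (Y B B' : Matrix (Fin n) (Fin n) (ZMod q)) :
    tableChar Y (B + B') = tableChar Y B * tableChar Y B' := by
  simp [tableChar, tablePairing_add_right, AddChar.map_add_eq_mul]

lemma tableChar_add_left (Y Y' B : Matrix (Fin n) (Fin n) (ZMod q)) :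
    tableChar (Y + Y') B = tableChar Y B * tableChar Y' B := by
  simp [tableChar, tablePairing_add_left, AddChar.map_add_eq_mul]

lemma tableChar_neg_right (Y B : Matrix (Fin n) (Fin n) (ZMod q)) :
    tableChar Y (-B) = (starRingEnd ℂ) (tableChar Y B) := by
  simp [tableChar, tablePairing_neg_right, AddChar.map_neg_eq_conj]

lemma tableChar_neg_left (Y B : Matrix (Fin n) (Fin n) (ZMod q)) :
    tableChar (-Y) B = (starRingEnd ℂ) (tableChar Y B) := by
  simp [tableChar, tablePairing_neg_left, AddChar.map_neg_eq_conj]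

@[simp] lemma norm_tableChar (Y B : Matrix (Fin n) (Fin n) (ZMod q)) : ‖tableChar Y B‖ = 1 := by
  simp [tableChar]

lemma tableChar_eq_one_iff (Y B : Matrix (Fin n) (Fin n) (ZMod q)) :
    tableChar Y B = 1 ↔ tablePairing Y B = 0 := by
  rw [tableChar, ← AddChar.map_zero_eq_one (ZMod.stdAddChar (N := q))]
  exact ZMod.injective_stdAddChar.eq_iff

/-- Translating `Y` by a unit matrix at a nonzero entry of `D` multiplies the sum by a scalar other
than 1. -/
lemma sum_tableChar_eq_zero {D : Matrix (Fin n) (Fin n) (ZMod q)} (hD : D ≠ 0) :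
    ∑ Y, tableChar Y D = 0 := by
  obtain ⟨a, b, hab⟩ : ∃ a b, D a b ≠ 0 := by
    by_contra! h
    exact hD (by ext a b; simpa using h a b)
  have hshift : ∑ Y, tableChar Y D = tableChar (Matrix.single a b 1) D * ∑ Y, tableChar Y D := by
    rw [Finset.mul_sum, ← Equiv.sum_comp (Equiv.addLeft (Matrix.single a b (1 : ZMod q)))]
    exact Finset.sum_congr rfl fun Y _ => by simp [tableChar_add_left]
  have hne : tableChar (Matrix.single a b 1) D ≠ 1 := by
    rw [Ne, tableChar_eq_one_iff, tablePairing_single_left]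
    exact hab
  by_contra hS
  exact hne (mul_right_cancel₀ hS (by rw [one_mul]; exact hshift.symm))

/-- Parseval's identity for a function that lives on a finite set of matrices. -/
lemma parseval_tables {ι : Type*} [Fintype ι] (e : ι → Matrix (Fin n) (Fin n) (ZMod q))
    (he : Function.Injective e) (h : ι → ℝ) :
    ∑ Y, ‖∑ b, (h b : ℂ) * tableChar Y (e b)‖ ^ 2
      = Fintype.card (Matrix (Fin n) (Fin n) (ZMod q)) * ∑ b, h b ^ 2 := by
  classical
  have hterm : ∀ Y, ((‖∑ b, (h b : ℂ) * tableChar Y (e b)‖ ^ 2 : ℝ) : ℂ)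
      = ∑ b, ∑ b', (h b : ℂ) * h b' * tableChar Y (e b + -e b') := by
    intro Y
    push_cast
    rw [← Complex.mul_conj', map_sum, Finset.sum_mul_sum]
    refine Finset.sum_congr rfl fun b _ => Finset.sum_congr rfl fun b' _ => ?_
    rw [map_mul, Complex.conj_ofReal, tableChar_add_right, tableChar_neg_right]
    ring
  have hC : ((∑ Y, ‖∑ b, (h b : ℂ) * tableChar Y (e b)‖ ^ 2 : ℝ) : ℂ)
      = ((Fintype.card (Matrix (Fin n) (Fin n) (ZMod q)) * ∑ b, h b ^ 2 : ℝ) : ℂ) := by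
    rw [Complex.ofReal_sum, Finset.sum_congr rfl fun Y _ => hterm Y, Finset.sum_comm]
    push_cast
    rw [Finset.mul_sum]
    refine Finset.sum_congr rfl fun b _ => ?_
    -- Off the diagonal the sum over `Y` vanishes by orthogonality, because `e` is injective.
    rw [Finset.sum_comm, Finset.sum_eq_single b]
    · simp [(tableChar_eq_one_iff _ _).2, tablePairing]
      ring
    · intro b' _ hb'
      rw [← Finset.mul_sum, sum_tableChar_eq_zero, mul_zero]
      rw [← sub_eq_add_neg, sub_ne_zero]
      exact fun h => hb' (he h).symm
    · simp
  exact_mod_cast hC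

/-- The table reached from `A` by the move `m`. -/
def ContingencyTable.move {row col : Fin n → ZMod q} (A : ContingencyTable n q row col)
    (m : (Fin n × Fin n) × (Fin n × Fin n) × Bool) : ContingencyTable n q row col :=
  ⟨A.1 + dgIncrement q m, fun i => by
    simp [Finset.sum_add_distrib, dgIncrement_row_sum, A.2.1 i], fun j => by
    simp [Finset.sum_add_distrib, dgIncrement_col_sum, A.2.2 j]⟩

/-- Summation against one step of the walk is an average over the moves. -/
lemma sum_dgTransition_mul {row col : Fin n → ZMod q} (A : ContingencyTable n q row col)
    (f : ContingencyTable n q row col → ℂ) :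
    ∑ B, (dgTransition row col A B : ℂ) * f B
      = (∑ m ∈ dgChoices n, f (A.move m)) / (dgChoices n).card := by
  classical
  have h1 : ∀ B, (dgTransition row col A B : ℂ) * f B
      = (∑ m ∈ dgChoices n, if A.move m = B then f B else 0) / (dgChoices n).card := by
    intro B
    rw [← Finset.sum_filter, Finset.sum_const]
    simp only [dgTransition, Matrix.of_apply, nsmul_eq_mul]
    have : (dgChoices n).filter (fun m => A.1 + dgIncrement q m = B.1)
        = (dgChoices n).filter (fun m => A.move m = B) := by
      refine Finset.filter_congr fun m _ => ?_
      rw [Subtype.ext_iff]; rfl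
    rw [this]
    push_cast
    ring
  rw [Finset.sum_congr rfl fun B _ => h1 B, ← Finset.sum_div, Finset.sum_comm]
  simp

/-- Turning the coin over negates the increment and conjugates the character, so the sum is real. -/
lemma sum_dgChoices_tableChar (Y : Matrix (Fin n) (Fin n) (ZMod q)) :
    ∑ m ∈ dgChoices n, tableChar Y (dgIncrement q m)
      = ((∑ m ∈ dgChoices n, (tableChar Y (dgIncrement q m)).re : ℝ) : ℂ) := by
  have hconj : ∑ m ∈ dgChoices n, tableChar Y (dgIncrement q m)
      = ∑ m ∈ dgChoices n, (starRingEnd ℂ) (tableChar Y (dgIncrement q m)) := by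
    refine Finset.sum_nbij' (fun m => (m.1, m.2.1, !m.2.2)) (fun m => (m.1, m.2.1, !m.2.2))
      ?_ ?_ ?_ ?_ ?_
    · intro m hm; simpa [dgChoices] using hm
    · intro m hm; simpa [dgChoices] using hm
    · intro m _; simp
    · intro m _; simp
    · intro m _; simp [dgIncrement_not, tableChar_neg_right]
  apply Complex.ext
  · simp
  · have := congrArg Complex.im hconj
    simp at this ⊢
    linarith

lemma sum_dgTransition_mul_tableChar {row col : Fin n → ZMod q}
    (Y : Matrix (Fin n) (Fin n) (ZMod q)) (A : ContingencyTable n q row col) :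
    ∑ B : ContingencyTable n q row col, (dgTransition row col A B : ℂ) * tableChar Y B.1
      = walkEigenvalue Y * tableChar Y A.1 := by
  rw [sum_dgTransition_mul A (fun B => tableChar Y B.1)]
  have : ∑ m ∈ dgChoices n, tableChar Y (A.move m).1
      = tableChar Y A.1 * ∑ m ∈ dgChoices n, tableChar Y (dgIncrement q m) := by
    rw [Finset.mul_sum]
    exact Finset.sum_congr rfl fun m _ => tableChar_add_right _ _ _
  rw [this, sum_dgChoices_tableChar, walkEigenvalue]
  push_cast
  ring

lemma sum_dgTransition_pow_mul_tableChar {row col : Fin n → ZMod q}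
    (Y : Matrix (Fin n) (Fin n) (ZMod q)) (t : ℕ) (A : ContingencyTable n q row col) :
    ∑ B : ContingencyTable n q row col, (((dgTransition row col ^ t) A B : ℝ) : ℂ) * tableChar Y B.1
      = walkEigenvalue Y ^ t * tableChar Y A.1 := by
  classical
  induction t with
  | zero => simp [Matrix.one_apply, apply_ite Complex.ofReal, ite_mul]
  | succ t ih =>
    simp only [pow_succ, Matrix.mul_apply]
    push_cast
    simp only [Finset.sum_mul]
    rw [Finset.sum_comm]
    calc _ = ∑ B : ContingencyTable n q row col, (((dgTransition row col ^ t) A B : ℝ) : ℂ)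
          * (walkEigenvalue Y * tableChar Y B.1) := by
          refine Finset.sum_congr rfl fun B _ => ?_
          rw [← sum_dgTransition_mul_tableChar, Finset.mul_sum]
          exact Finset.sum_congr rfl fun D _ => by ring
      _ = walkEigenvalue Y * ∑ B : ContingencyTable n q row col,
          (((dgTransition row col ^ t) A B : ℝ) : ℂ) * tableChar Y B.1 := by
          rw [Finset.mul_sum]
          exact Finset.sum_congr rfl fun D _ => by ring
      _ = _ := by rw [ih]; ring

lemma dgTransition_pow_nonneg {row col : Fin n → ZMod q} (t : ℕ)
    (A B : ContingencyTable n q row col) : 0 ≤ (dgTransition row col ^ t) A B := by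
  classical
  induction t generalizing B with
  | zero => rw [pow_zero, Matrix.one_apply]; split_ifs <;> norm_num
  | succ t ih =>
    rw [pow_succ, Matrix.mul_apply]
    exact Finset.sum_nonneg fun D _ => mul_nonneg (ih D) (by
      simp only [dgTransition, Matrix.of_apply]; positivity)

end Characters

/-! ### Formulas and bounds for the eigenvalues -/

section Eigenvalues

lemma stdAddChar_re_neg {q : ℕ} [NeZero q] (z : ZMod q) :
    (ZMod.stdAddChar (-z)).re = (ZMod.stdAddChar z).re := by
  rw [AddChar.map_neg_eq_conj, Complex.conj_re]

lemma abs_stdAddChar_re_le_one {q : ℕ} [NeZero q] (z : ZMod q) :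
    |(ZMod.stdAddChar z).re| ≤ 1 := by
  have := Complex.abs_re_le_norm (ZMod.stdAddChar z)
  simpa using this

lemma stdAddChar_natCast_re {q : ℕ} [NeZero q] (m : ℕ) :
    (ZMod.stdAddChar (m : ZMod q)).re = Real.cos (2 * Real.pi * m / q) := by
  have h := ZMod.stdAddChar_coe (N := q) (m : ℤ)
  simp only [Int.cast_natCast] at h
  rw [h, show (2 * (Real.pi : ℂ) * Complex.I * m / q)
    = ((2 * Real.pi * m / q : ℝ) : ℂ) * Complex.I by push_cast; ring, Complex.exp_ofReal_mul_I_re]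

lemma stdAddChar_one_re {q : ℕ} [NeZero q] :
    (ZMod.stdAddChar (1 : ZMod q)).re = Real.cos (2 * Real.pi / q) := by
  simpa using stdAddChar_natCast_re (q := q) 1

/-- The residues `v` and `q - v` have the same cosine, so one may take `v ≤ q / 2`, where the cosine
decreases. -/
lemma stdAddChar_re_le_cos {q : ℕ} [NeZero q] {z : ZMod q} (hz : z ≠ 0) :
    (ZMod.stdAddChar z).re ≤ Real.cos (2 * Real.pi / q) := by
  have hq : (0 : ℝ) < q := by exact_mod_cast Nat.pos_of_ne_zero (NeZero.ne q)
  have hv1 : 1 ≤ z.val := Nat.one_le_iff_ne_zero.2 ((ZMod.val_ne_zero z).2 hz)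
  have hv2 : z.val + 1 ≤ q := ZMod.val_lt z
  have hpi := Real.pi_pos
  have key : ∀ m : ℝ, 1 ≤ m → 2 * m ≤ q →
      Real.cos (2 * Real.pi * m / q) ≤ Real.cos (2 * Real.pi / q) := by
    intro m h1 h2
    apply Real.cos_le_cos_of_nonneg_of_le_pi
    · positivity
    · rw [div_le_iff₀ hq]; nlinarith
    · rw [div_le_div_iff_of_pos_right hq]; exact le_mul_of_one_le_right (by positivity) h1
  rw [← ZMod.natCast_zmod_val z, stdAddChar_natCast_re]
  have hv1' : (1 : ℝ) ≤ z.val := by exact_mod_cast hv1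
  have hv2' : (z.val : ℝ) + 1 ≤ q := by exact_mod_cast hv2
  rcases le_total (2 * (z.val : ℝ)) q with h | h
  · exact key _ hv1' h
  · have h3 := key (q - z.val) (by linarith) (by linarith)
    rwa [show 2 * Real.pi * (q - z.val) / q = 2 * Real.pi - 2 * Real.pi * z.val / q by
      field_simp, Real.cos_two_pi_sub] at h3

lemma one_sub_cos_pos {q : ℕ} (hq : 2 ≤ q) : 0 < 1 - Real.cos (2 * Real.pi / q) := by
  have hq' : (2 : ℝ) ≤ q := by exact_mod_cast hq
  have hpi := Real.pi_pos
  have h : Real.cos (2 * Real.pi / q) < Real.cos 0 := by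
    apply Real.cos_lt_cos_of_nonneg_of_le_pi le_rfl
    · rw [div_le_iff₀ (by linarith)]; nlinarith
    · positivity
  rw [Real.cos_zero] at h
  linarith

lemma sum_ne_eq_two_mul_sum_lt {n : ℕ} (G : Fin n → Fin n → ℝ) (hG : ∀ i j, G i j = G j i) :
    ∑ i, ∑ j, (if i ≠ j then G i j else 0) = 2 * ∑ i, ∑ j, if i < j then G i j else 0 := by
  have h : ∑ i, ∑ j, (if i ≠ j then G i j else 0)
      = ∑ i, ∑ j, (if i < j then G i j else 0) + ∑ i, ∑ j, if j < i then G i j else 0 := by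
    simp only [← Finset.sum_add_distrib]
    refine Finset.sum_congr rfl fun i _ => Finset.sum_congr rfl fun j _ => ?_
    rcases lt_trichotomy i j with hij | hij | hij
    · simp [hij, hij.ne, hij.not_gt]
    · simp [hij]
    · simp [hij, hij.ne', hij.not_gt]
  rw [h, two_mul]
  congr 1
  rw [Finset.sum_comm]
  exact Finset.sum_congr rfl fun i _ => Finset.sum_congr rfl fun j _ => by rw [hG]

/-- Sums of symmetric functions over the moves are sums over ordered quadruples of indices. -/
lemma two_mul_sum_dgChoices {n : ℕ} (F : Fin n → Fin n → Fin n → Fin n → ℝ)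
    (hr : ∀ i j k l, F i j k l = F j i k l) (hc : ∀ i j k l, F i j k l = F i j l k) :
    2 * ∑ m ∈ dgChoices n, F m.1.1 m.1.2 m.2.1.1 m.2.1.2
      = ∑ i, ∑ j, if i ≠ j then ∑ k, ∑ l, (if k ≠ l then F i j k l else 0) else 0 := by
  simp_rw [fun i j => sum_ne_eq_two_mul_sum_lt (F i j) (hc i j)]
  rw [sum_ne_eq_two_mul_sum_lt _ (fun i j => by
    congr 1
    exact Finset.sum_congr rfl fun k _ => Finset.sum_congr rfl fun l _ => by rw [hr])]
  congr 1
  -- The leading 2 has been matched with the two orders of the rows; the 2 from the orders of the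
  -- columns is matched by the two coin outcomes.
  rw [dgChoices, Finset.sum_filter]
  simp only [Fintype.sum_prod_type, Fintype.sum_bool]
  refine Finset.sum_congr rfl fun i _ => Finset.sum_congr rfl fun j _ => ?_
  by_cases hij : i < j
  · simp only [hij, if_true, true_and, Finset.mul_sum]
    refine Finset.sum_congr rfl fun k _ => Finset.sum_congr rfl fun l _ => ?_
    split_ifs <;> ring
  · simp [hij]

lemma two_mul_card_dgChoices {n : ℕ} :
    2 * ((dgChoices n).card : ℝ) = ((n : ℝ) * (n - 1)) ^ 2 := by
  have h := two_mul_sum_dgChoices (n := n) (fun _ _ _ _ => 1) (fun _ _ _ _ => rfl)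
    (fun _ _ _ _ => rfl)
  have h1 : ∀ f : ℝ, ∑ i : Fin n, ∑ j : Fin n, (if i ≠ j then f else 0) = n * (n - 1) * f := by
    intro f
    have : ∀ i j : Fin n, (if i ≠ j then f else 0) = f - if i = j then f else 0 := by
      intro i j; split_ifs <;> simp_all
    simp_rw [this]
    simp
    ring
  simp only [Finset.sum_const, nsmul_eq_mul, mul_one] at h
  rw [h, h1, h1]
  ring

variable {n q : ℕ} [NeZero q]

lemma tableChar_dgIncrement_re (Y : Matrix (Fin n) (Fin n) (ZMod q))
    (m : (Fin n × Fin n) × (Fin n × Fin n) × Bool) :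
    (tableChar Y (dgIncrement q m)).re
      = (ZMod.stdAddChar (rectDiff Y m.1.1 m.1.2 m.2.1.1 m.2.1.2)).re := by
  unfold dgIncrement
  split_ifs
  · rw [tableChar, tablePairing_dgCorner]
  · rw [tableChar, tablePairing_neg_right, tablePairing_dgCorner, stdAddChar_re_neg]

lemma card_dgChoices_pos (hn : 2 ≤ n) : 0 < ((dgChoices n).card : ℝ) := by
  have h := two_mul_card_dgChoices (n := n)
  have hn' : (2 : ℝ) ≤ n := by exact_mod_cast hn
  have : 0 < ((n : ℝ) * (n - 1)) ^ 2 := by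
    apply pow_pos; apply mul_pos <;> linarith
  linarith

lemma one_sub_walkEigenvalue_mul (hn : 2 ≤ n) (Y : Matrix (Fin n) (Fin n) (ZMod q)) :
    (1 - walkEigenvalue Y) * ((n : ℝ) * (n - 1)) ^ 2
      = ∑ i, ∑ j, ∑ k, ∑ l, (1 - (ZMod.stdAddChar (rectDiff Y i j k l)).re) := by
  have hc := card_dgChoices_pos hn
  have h := two_mul_sum_dgChoices (n := n)
    (fun i j k l => 1 - (ZMod.stdAddChar (rectDiff Y i j k l)).re)
    (fun i j k l => by
      rw [show rectDiff Y j i k l = -rectDiff Y i j k l by simp only [rectDiff]; ring,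
        stdAddChar_re_neg])
    (fun i j k l => by
      rw [show rectDiff Y i j l k = -rectDiff Y i j k l by simp only [rectDiff]; ring,
        stdAddChar_re_neg])
  calc (1 - walkEigenvalue Y) * ((n : ℝ) * (n - 1)) ^ 2
      = 2 * ∑ m ∈ dgChoices n,
          (1 - (ZMod.stdAddChar (rectDiff Y m.1.1 m.1.2 m.2.1.1 m.2.1.2)).re) := by
        rw [← two_mul_card_dgChoices, walkEigenvalue, Finset.sum_sub_distrib]
        simp only [tableChar_dgIncrement_re, Finset.sum_const, nsmul_eq_mul, mul_one]
        field_simp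
    _ = _ := by
        rw [h]
        refine Finset.sum_congr rfl fun i _ => Finset.sum_congr rfl fun j _ => ?_
        -- Degenerate rectangles have corner sum zero, so the restrictions `i ≠ j` and `k ≠ l` can
        -- be dropped.
        by_cases hij : i = j
        · subst hij; simp [rectDiff]
        · rw [if_pos hij]
          refine Finset.sum_congr rfl fun k _ => Finset.sum_congr rfl fun l _ => ?_
          by_cases hkl : k = l
          · subst hkl; simp [rectDiff]
          · rw [if_pos hkl]

lemma walkEigenvalue_le_one (hn : 2 ≤ n) (Y : Matrix (Fin n) (Fin n) (ZMod q)) :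
    walkEigenvalue Y ≤ 1 := by
  have hc := card_dgChoices_pos hn
  rw [walkEigenvalue, div_le_one hc]
  calc _ ≤ ∑ m ∈ dgChoices n, (1 : ℝ) := Finset.sum_le_sum fun m _ => by
        rw [tableChar_dgIncrement_re]; exact (abs_le.1 (abs_stdAddChar_re_le_one _)).2
    _ = _ := by simp

lemma walkEigenvalue_eq_one_of_rectDiff (hn : 2 ≤ n) {Y : Matrix (Fin n) (Fin n) (ZMod q)}
    (hY : ∀ i j k l, rectDiff Y i j k l = 0) : walkEigenvalue Y = 1 := by
  have hc := card_dgChoices_pos hn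
  rw [walkEigenvalue, div_eq_one_iff_eq hc.ne']
  simp [tableChar_dgIncrement_re, hY]

/-- The sum of all rectangle characters is a sum of squared norms. -/
lemma cube_le_sum_rectDiff_re (Y : Matrix (Fin n) (Fin n) (ZMod q)) :
    (n : ℝ) ^ 3 ≤ ∑ i, ∑ j, ∑ k, ∑ l, (ZMod.stdAddChar (rectDiff Y i j k l)).re := by
  have hsq : ∀ i j, ∑ k, ∑ l, (ZMod.stdAddChar (rectDiff Y i j k l)).re
      = ‖∑ k, ZMod.stdAddChar (Y i k - Y j k)‖ ^ 2 := by
    intro i j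
    have : ((‖∑ k, ZMod.stdAddChar (Y i k - Y j k)‖ ^ 2 : ℝ) : ℂ)
        = ∑ k, ∑ l, ZMod.stdAddChar (rectDiff Y i j k l) := by
      push_cast
      rw [← Complex.conj_mul', map_sum, Finset.sum_mul_sum]
      refine Finset.sum_congr rfl fun k _ => Finset.sum_congr rfl fun l _ => ?_
      rw [← AddChar.map_neg_eq_conj, ← AddChar.map_add_eq_mul]
      congr 1
      simp only [rectDiff]; ring
    have h2 := congrArg Complex.re this
    rw [Complex.ofReal_re] at h2
    rw [h2]; simp
  simp_rw [hsq]
  calc (n : ℝ) ^ 3 = ∑ i : Fin n, ‖∑ k, ZMod.stdAddChar (Y i k - Y i k)‖ ^ 2 := by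
        simp; ring
    _ ≤ _ := Finset.sum_le_sum fun i _ => Finset.single_le_sum
        (f := fun j => ‖∑ k, ZMod.stdAddChar (Y i k - Y j k)‖ ^ 2)
        (fun j _ => by positivity) (Finset.mem_univ i)

/-- The diagonal terms `i = j` of the sum of squares already give `n ^ 3`, so `1 - λ ≤ (n ^ 4 - n ^
3) / (n (n - 1)) ^ 2 = n / (n - 1)`, which is at most `4 / 3`. -/
lemma neg_one_third_le_walkEigenvalue (hn : 4 ≤ n) (Y : Matrix (Fin n) (Fin n) (ZMod q)) :
    -(1 / 3) ≤ walkEigenvalue Y := by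
  have h1 := one_sub_walkEigenvalue_mul (by omega) Y
  have h2 := cube_le_sum_rectDiff_re Y
  simp only [Finset.sum_sub_distrib, Finset.sum_const, Finset.card_univ, Fintype.card_fin,
    nsmul_eq_mul, mul_one] at h1
  have hn' : (4 : ℝ) ≤ n := by exact_mod_cast hn
  have hp : 0 < (n : ℝ) ^ 2 * (n - 1) := by
    apply mul_pos <;> [positivity; linarith]
  have h3 : (1 - walkEigenvalue Y) * (n - 1) ≤ n := by
    by_contra! h
    have := mul_lt_mul_of_pos_left h hp
    nlinarith
  nlinarith

/-- The number of (ordered, possibly degenerate) rectangles on which `Y` has a non-zero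
alternating corner sum. -/
def rectCount (Y : Matrix (Fin n) (Fin n) (ZMod q)) : ℝ :=
  ∑ i, ∑ j, ∑ k, ∑ l, if rectDiff Y i j k l = 0 then 0 else 1

lemma rectCount_le_one_sub_walkEigenvalue (hn : 2 ≤ n) (Y : Matrix (Fin n) (Fin n) (ZMod q)) :
    (1 - Real.cos (2 * Real.pi / q)) * rectCount Y ≤ (1 - walkEigenvalue Y) * (n : ℝ) ^ 4 := by
  have hn' : (2 : ℝ) ≤ n := by exact_mod_cast hn
  calc (1 - Real.cos (2 * Real.pi / q)) * rectCount Y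
      ≤ (1 - walkEigenvalue Y) * ((n : ℝ) * (n - 1)) ^ 2 := by
        rw [one_sub_walkEigenvalue_mul hn, rectCount]
        simp only [Finset.mul_sum]
        refine Finset.sum_le_sum fun i _ => Finset.sum_le_sum fun j _ =>
          Finset.sum_le_sum fun k _ => Finset.sum_le_sum fun l _ => ?_
        split_ifs with h
        · rw [h]; simp
        · have := stdAddChar_re_le_cos h
          linarith
    _ ≤ _ := by
        apply mul_le_mul_of_nonneg_left _ (by linarith [walkEigenvalue_le_one hn Y])
        rw [show (n : ℝ) ^ 4 = (n * n) ^ 2 by ring]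
        apply pow_le_pow_left₀ (mul_nonneg _ _) <;> nlinarith

end Eigenvalues

/-! ### Classes of characters and the `ℓ²` upper bound lemma -/

/-- The matrices of the form `u i + v j`: those whose characters are constant on the set of
contingency tables. -/
def IsAdditiveTable {n q : ℕ} (Y : Matrix (Fin n) (Fin n) (ZMod q)) : Prop :=
  ∀ i j k l, rectDiff Y i j k l = 0

/-- The number of non-zero entries. -/
def tableWeight {n q : ℕ} (Y : Matrix (Fin n) (Fin n) (ZMod q)) : ℕ :=
  (Finset.univ.filter fun p : Fin n × Fin n => Y p.1 p.2 ≠ 0).card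

/-- The matrices with the fewest non-zero entries modulo those of the form `u i + v j`. -/
def IsMinimalTable {n q : ℕ} (Y : Matrix (Fin n) (Fin n) (ZMod q)) : Prop :=
  ∀ Z, IsAdditiveTable Z → tableWeight Y ≤ tableWeight (Y + Z)

section Spectral

variable {n q : ℕ}

lemma rectDiff_add (Y Z : Matrix (Fin n) (Fin n) (ZMod q)) (i j k l : Fin n) :
    rectDiff (Y + Z) i j k l = rectDiff Y i j k l + rectDiff Z i j k l := by
  simp only [rectDiff, Matrix.add_apply]; ring

lemma IsAdditiveTable.add {Y Z : Matrix (Fin n) (Fin n) (ZMod q)} (hY : IsAdditiveTable Y)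
    (hZ : IsAdditiveTable Z) : IsAdditiveTable (Y + Z) := fun i j k l => by
  rw [rectDiff_add, hY, hZ, add_zero]

lemma isAdditiveTable_add_iff {Y Z : Matrix (Fin n) (Fin n) (ZMod q)} (hZ : IsAdditiveTable Z) :
    IsAdditiveTable (Y + Z) ↔ IsAdditiveTable Y :=
  forall₄_congr fun i j k l => by rw [rectDiff_add, hZ, add_zero]

lemma exists_isMinimalTable_add (Y : Matrix (Fin n) (Fin n) (ZMod q)) :
    ∃ Z, IsAdditiveTable Z ∧ IsMinimalTable (Y + Z) := by
  classical
  have hex : ∃ w, ∃ Z, IsAdditiveTable Z ∧ tableWeight (Y + Z) = w :=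
    ⟨_, 0, fun i j k l => by simp [rectDiff], rfl⟩
  obtain ⟨Z, hZ, hw⟩ := Nat.find_spec hex
  refine ⟨Z, hZ, fun Z' hZ' => ?_⟩
  rw [hw, add_assoc]
  exact Nat.find_min' hex ⟨Z + Z', hZ.add hZ', rfl⟩

/-- Vanishing corner sums mean `Y i j = Y i 0 + Y 0 j - Y 0 0`; each summand pairs `D` through its
row or column sums. -/
lemma tablePairing_eq_zero_of_isAdditiveTable {Y D : Matrix (Fin n) (Fin n) (ZMod q)}
    (hY : IsAdditiveTable Y) (hr : ∀ i, ∑ j, D i j = 0) (hc : ∀ j, ∑ i, D i j = 0) :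
    tablePairing Y D = 0 := by
  rcases Nat.eq_zero_or_pos n with rfl | hn
  · simp [tablePairing]
  have h : ∀ i j, Y i j * D i j = Y i ⟨0, hn⟩ * D i j + Y ⟨0, hn⟩ j * D i j
      - Y ⟨0, hn⟩ ⟨0, hn⟩ * D i j := by
    intro i j
    have := hY i ⟨0, hn⟩ ⟨0, hn⟩ j
    simp only [rectDiff] at this
    rw [← add_mul, ← sub_mul]
    congr 1
    linear_combination this
  simp only [tablePairing, h, Finset.sum_add_distrib, Finset.sum_sub_distrib]
  rw [Finset.sum_comm (f := fun i j => Y ⟨0, hn⟩ j * D i j)]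
  simp only [← Finset.mul_sum, hr, hc]
  simp

variable [NeZero q]

lemma walkEigenvalue_add_of_isAdditiveTable {Y Z : Matrix (Fin n) (Fin n) (ZMod q)}
    (hZ : IsAdditiveTable Z) : walkEigenvalue (Y + Z) = walkEigenvalue Y := by
  simp only [walkEigenvalue, tableChar_dgIncrement_re, rectDiff_add]
  simp only [hZ _ _ _ _, add_zero]

variable {row col : Fin n → ZMod q}

lemma tableChar_eq_of_isAdditiveTable {Y : Matrix (Fin n) (Fin n) (ZMod q)}
    (hY : IsAdditiveTable Y) (A B : ContingencyTable n q row col) :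
    tableChar Y B.1 = tableChar Y A.1 := by
  have h : tableChar Y (B.1 + -A.1) = 1 := by
    rw [tableChar_eq_one_iff]
    apply tablePairing_eq_zero_of_isAdditiveTable hY
    · intro i; simp [Finset.sum_add_distrib, A.2.1, B.2.1]
    · intro j; simp [Finset.sum_add_distrib, A.2.2, B.2.2]
  have h2 : B.1 = (B.1 + -A.1) + A.1 := by simp
  rw [h2, tableChar_add_right, h, one_mul]

/-- A move with nonzero corner sum permutes the tables and multiplies the character by a scalar
other than 1. -/
lemma sum_tableChar_contingencyTable_eq_zero {Y : Matrix (Fin n) (Fin n) (ZMod q)}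
    (hY : ¬ IsAdditiveTable Y) :
    ∑ B : ContingencyTable n q row col, tableChar Y B.1 = 0 := by
  simp only [IsAdditiveTable, not_forall] at hY
  obtain ⟨i, j, k, l, h⟩ := hY
  have hinj : Function.Injective
      fun B : ContingencyTable n q row col => B.move ((i, j), (k, l), true) := by
    intro B B' hBB
    have := congrArg Subtype.val hBB
    exact Subtype.ext (add_right_cancel this)
  have hshift : ∑ B : ContingencyTable n q row col, tableChar Y B.1
      = tableChar Y (dgCorner q i j k l) * ∑ B : ContingencyTable n q row col, tableChar Y B.1 := by
    rw [Finset.mul_sum]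
    refine ((Finite.injective_iff_bijective.1 hinj).sum_comp
      (fun B : ContingencyTable n q row col => tableChar Y B.1)).symm.trans ?_
    refine Finset.sum_congr rfl fun B _ => ?_
    simp [ContingencyTable.move, dgIncrement, tableChar_add_right, mul_comm]
  have hne : tableChar Y (dgCorner q i j k l) ≠ 1 := by
    rwa [Ne, tableChar_eq_one_iff, tablePairing_dgCorner]
  by_contra hS
  exact hne (mul_right_cancel₀ hS (by rw [one_mul]; exact hshift.symm))

-- Parseval for the constant function 1 gives total mass `M N`, with `M` the number of matrices and
-- `N` the number of tables, and each additive matrix contributes `N ^ 2` to it. This replaces a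
-- computation of the two cardinalities.
open Classical in
lemma card_mul_card_isAdditiveTable_le [Nonempty (ContingencyTable n q row col)] :
    (Fintype.card (ContingencyTable n q row col) : ℝ)
        * (Finset.univ.filter (IsAdditiveTable (n := n) (q := q))).card
      ≤ Fintype.card (Matrix (Fin n) (Fin n) (ZMod q)) := by
  obtain ⟨A⟩ := ‹Nonempty (ContingencyTable n q row col)›
  have hN : 0 < (Fintype.card (ContingencyTable n q row col) : ℝ) := by
    exact_mod_cast Fintype.card_pos_iff.2 ⟨A⟩
  have h := parseval_tables (n := n) (q := q) (fun B : ContingencyTable n q row col => B.1)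
    Subtype.val_injective (fun _ => 1)
  simp only [Complex.ofReal_one, one_mul, one_pow, Finset.sum_const, Finset.card_univ,
    nsmul_eq_mul, mul_one] at h
  have h2 : ∑ Y ∈ Finset.univ.filter (IsAdditiveTable (n := n) (q := q)),
      (Fintype.card (ContingencyTable n q row col) : ℝ) ^ 2
      ≤ ∑ Y : Matrix (Fin n) (Fin n) (ZMod q),
        ‖∑ B : ContingencyTable n q row col, tableChar Y B.1‖ ^ 2 := by
    rw [← Finset.sum_filter_add_sum_filter_not Finset.univ (IsAdditiveTable (n := n) (q := q))
      (fun Y => ‖∑ B : ContingencyTable n q row col, tableChar Y B.1‖ ^ 2)]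
    refine le_add_of_le_of_nonneg (Finset.sum_le_sum fun Y hY => ?_)
      (Finset.sum_nonneg fun _ _ => by positivity)
    rw [Finset.sum_congr rfl fun B _ =>
      tableChar_eq_of_isAdditiveTable (Finset.mem_filter.1 hY).2 A B]
    simp
  rw [h, Finset.sum_const, nsmul_eq_mul] at h2
  nlinarith

-- Every class contains a minimal matrix, and each minimal matrix is reached from exactly as many
-- `Y` as there are additive matrices.
open Classical in
lemma sum_not_isAdditiveTable_le (F : Matrix (Fin n) (Fin n) (ZMod q) → ℝ) (hF : ∀ Y, 0 ≤ F Y)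
    (hinv : ∀ Y Z, IsAdditiveTable Z → F (Y + Z) = F Y) :
    ∑ Y ∈ Finset.univ.filter (fun Y => ¬ IsAdditiveTable Y), F Y
      ≤ (Finset.univ.filter (IsAdditiveTable (n := n) (q := q))).card
        * ∑ Y ∈ Finset.univ.filter (fun Y => ¬ IsAdditiveTable Y ∧ IsMinimalTable Y), F Y := by
  calc ∑ Y ∈ Finset.univ.filter (fun Y => ¬ IsAdditiveTable Y), F Y
      ≤ ∑ Y ∈ Finset.univ.filter (fun Y => ¬ IsAdditiveTable Y),
          ∑ Z ∈ Finset.univ.filter (IsAdditiveTable (n := n) (q := q)),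
            if ¬ IsAdditiveTable (Y + Z) ∧ IsMinimalTable (Y + Z) then F (Y + Z) else 0 := by
        refine Finset.sum_le_sum fun Y hY => ?_
        obtain ⟨Z, hZ, hmin⟩ := exists_isMinimalTable_add Y
        have hY' := (Finset.mem_filter.1 hY).2
        refine le_trans (le_of_eq ?_) (Finset.single_le_sum
          (f := fun Z => if ¬ IsAdditiveTable (Y + Z) ∧ IsMinimalTable (Y + Z)
            then F (Y + Z) else 0)
          (fun Z _ => by split_ifs <;> simp [hF])
          (Finset.mem_filter.2 ⟨Finset.mem_univ Z, hZ⟩))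
        rw [isAdditiveTable_add_iff hZ, if_pos ⟨hY', hmin⟩, hinv _ _ hZ]
    _ ≤ ∑ Y, ∑ Z ∈ Finset.univ.filter (IsAdditiveTable (n := n) (q := q)),
            if ¬ IsAdditiveTable (Y + Z) ∧ IsMinimalTable (Y + Z) then F (Y + Z) else 0 :=
        Finset.sum_le_sum_of_subset_of_nonneg (Finset.filter_subset _ _) fun Y _ _ =>
          Finset.sum_nonneg fun Z _ => by split_ifs <;> simp [hF]
    _ = ∑ Z ∈ Finset.univ.filter (IsAdditiveTable (n := n) (q := q)),
          ∑ Y ∈ Finset.univ.filter (fun Y => ¬ IsAdditiveTable Y ∧ IsMinimalTable Y), F Y := by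
        rw [Finset.sum_comm]
        refine Finset.sum_congr rfl fun Z _ => ?_
        rw [Finset.sum_filter]
        exact Equiv.sum_comp (Equiv.addRight Z)
          (fun Y => if ¬ IsAdditiveTable Y ∧ IsMinimalTable Y then F Y else 0)
    _ = _ := by rw [Finset.sum_const, nsmul_eq_mul]

open Classical in
/-- The upper bound lemma: the `ℓ¹` distance to the uniform distribution is controlled by the
eigenvalues at representatives of minimal weight. -/
lemma sq_sum_abs_dgTransition_pow_sub_le (hn : 2 ≤ n) (t : ℕ)
    (A : ContingencyTable n q row col) :
    (∑ B : ContingencyTable n q row col, |(dgTransition row col ^ t) A B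
        - 1 / (Fintype.card (ContingencyTable n q row col) : ℝ)|) ^ 2
      ≤ ∑ Y ∈ Finset.univ.filter (fun Y : Matrix (Fin n) (Fin n) (ZMod q) =>
          ¬ IsAdditiveTable Y ∧ IsMinimalTable Y), (walkEigenvalue Y ^ 2) ^ t := by
  have : Nonempty (ContingencyTable n q row col) := ⟨A⟩
  set N : ℝ := (Fintype.card (ContingencyTable n q row col) : ℝ) with hN
  have hN0 : 0 < N := by rw [hN]; exact_mod_cast Fintype.card_pos
  set M : ℝ := (Fintype.card (Matrix (Fin n) (Fin n) (ZMod q)) : ℝ) with hM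
  have hM0 : 0 < M := by rw [hM]; exact_mod_cast Fintype.card_pos
  set h : ContingencyTable n q row col → ℝ := fun B => (dgTransition row col ^ t) A B - 1 / N
  set S := ∑ Y ∈ Finset.univ.filter (fun Y : Matrix (Fin n) (Fin n) (ZMod q) =>
          ¬ IsAdditiveTable Y ∧ IsMinimalTable Y), (walkEigenvalue Y ^ 2) ^ t with hS
  have hS0 : 0 ≤ S := Finset.sum_nonneg fun Y _ => by positivity
  have hcs : (∑ B, |h B|) ^ 2 ≤ N * ∑ B, h B ^ 2 := by
    have := sq_sum_le_card_mul_sum_sq (s := Finset.univ) (f := fun B => |h B|)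
    simpa [sq_abs] using this
  have hP := parseval_tables (n := n) (q := q) (fun B : ContingencyTable n q row col => B.1)
    Subtype.val_injective h
  have hhat : ∀ Y, ∑ B, (h B : ℂ) * tableChar Y B.1
      = (walkEigenvalue Y : ℂ) ^ t * tableChar Y A.1
        - 1 / N * ∑ B : ContingencyTable n q row col, tableChar Y B.1 := by
    intro Y
    rw [← sum_dgTransition_pow_mul_tableChar, Finset.mul_sum, ← Finset.sum_sub_distrib]
    refine Finset.sum_congr rfl fun B _ => ?_
    simp only [h]; push_cast; ring
  have hsum : ∑ Y, ‖∑ B, (h B : ℂ) * tableChar Y B.1‖ ^ 2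
      = ∑ Y ∈ Finset.univ.filter (fun Y : Matrix (Fin n) (Fin n) (ZMod q) => ¬ IsAdditiveTable Y),
        (walkEigenvalue Y ^ 2) ^ t := by
    rw [Finset.sum_filter]
    refine Finset.sum_congr rfl fun Y _ => ?_
    rw [hhat]
    split_ifs with hY
    · rw [walkEigenvalue_eq_one_of_rectDiff hn hY,
        Finset.sum_congr rfl fun B _ => tableChar_eq_of_isAdditiveTable hY A B]
      have : (N : ℂ) ≠ 0 := by exact_mod_cast hN0.ne'
      have h0 : (1 : ℂ) * tableChar Y A.1 - 1 / N * (N * tableChar Y A.1) = 0 := by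
        field_simp; ring
      simp only [Complex.ofReal_one, one_pow, Finset.sum_const, Finset.card_univ, nsmul_eq_mul]
      rw [show ((Fintype.card (ContingencyTable n q row col) : ℕ) : ℂ) = (N : ℂ) by simp [hN], h0]
      simp
    · rw [sum_tableChar_contingencyTable_eq_zero hY, mul_zero, sub_zero, norm_mul, norm_tableChar,
        norm_pow, Complex.norm_real, Real.norm_eq_abs, mul_one, ← pow_mul, mul_comm, pow_mul,
        sq_abs]
  have hcl := sum_not_isAdditiveTable_le (n := n) (q := q) (fun Y => (walkEigenvalue Y ^ 2) ^ t)
    (fun Y => by positivity) (fun Y Z hZ => by rw [walkEigenvalue_add_of_isAdditiveTable hZ])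
  have hU := card_mul_card_isAdditiveTable_le (row := row) (col := col)
  rw [← hsum, hP] at hcl
  set U : ℝ := ((Finset.univ.filter (IsAdditiveTable (n := n) (q := q))).card : ℝ)
  -- Parseval and the reduction to minimal matrices give `M ∑ h ^ 2 ≤ U S`; then `N U ≤ M` removes
  -- all cardinalities.
  refine hcs.trans ?_
  have h1 : N * (M * ∑ B, h B ^ 2) ≤ N * (U * S) := mul_le_mul_of_nonneg_left hcl hN0.le
  have h2 : N * U * S ≤ M * S := mul_le_mul_of_nonneg_right hU hS0
  refine le_of_mul_le_mul_left ?_ hM0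
  nlinarith

end Spectral

/-! ### Counting rectangles with nonzero corner sum -/

section Weights

variable {n q : ℕ}

/-- The indicator of the non-zero entries of a matrix. -/
def entryIndicator (Y : Matrix (Fin n) (Fin n) (ZMod q)) (i k : Fin n) : ℝ :=
  if Y i k = 0 then 0 else 1

lemma entryIndicator_nonneg (Y : Matrix (Fin n) (Fin n) (ZMod q)) (i k : Fin n) :
    0 ≤ entryIndicator Y i k := by
  unfold entryIndicator; split_ifs <;> norm_num

lemma entryIndicator_le_one (Y : Matrix (Fin n) (Fin n) (ZMod q)) (i k : Fin n) :
    entryIndicator Y i k ≤ 1 := by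
  unfold entryIndicator; split_ifs <;> norm_num

lemma tableWeight_eq_sum (Y : Matrix (Fin n) (Fin n) (ZMod q)) :
    (tableWeight Y : ℝ) = ∑ i, ∑ k, entryIndicator Y i k := by
  rw [tableWeight, Finset.card_filter, Nat.cast_sum, Fintype.sum_prod_type]
  refine Finset.sum_congr rfl fun i _ => Finset.sum_congr rfl fun k _ => ?_
  unfold entryIndicator
  split_ifs <;> simp_all

/-- The rows with more than `α n` non-zero entries. -/
noncomputable def heavyRows (α : ℝ) (Y : Matrix (Fin n) (Fin n) (ZMod q)) : Finset (Fin n) :=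
  Finset.univ.filter fun i => α * n < ∑ k, entryIndicator Y i k

/-- The columns with more than `α n` non-zero entries. -/
noncomputable def heavyCols (α : ℝ) (Y : Matrix (Fin n) (Fin n) (ZMod q)) : Finset (Fin n) :=
  Finset.univ.filter fun k => α * n < ∑ i, entryIndicator Y i k

/-- The number of non-zero entries that lie in a heavy row or a heavy column. -/
noncomputable def heavyWeight (α : ℝ) (Y : Matrix (Fin n) (Fin n) (ZMod q)) : ℝ :=
  ∑ i, ∑ k, if i ∈ heavyRows α Y ∨ k ∈ heavyCols α Y then entryIndicator Y i k else 0

/-- The number of non-zero entries that lie neither in a heavy row nor in a heavy column. -/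
noncomputable def lightWeight (α : ℝ) (Y : Matrix (Fin n) (Fin n) (ZMod q)) : ℝ :=
  ∑ i, ∑ k, if i ∈ heavyRows α Y ∨ k ∈ heavyCols α Y then 0 else entryIndicator Y i k

lemma lightWeight_add_heavyWeight (α : ℝ) (Y : Matrix (Fin n) (Fin n) (ZMod q)) :
    lightWeight α Y + heavyWeight α Y = tableWeight Y := by
  rw [tableWeight_eq_sum, lightWeight, heavyWeight]
  simp only [← Finset.sum_add_distrib]
  refine Finset.sum_congr rfl fun i _ => Finset.sum_congr rfl fun k _ => ?_
  split_ifs <;> simp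

lemma lightWeight_nonneg (α : ℝ) (Y : Matrix (Fin n) (Fin n) (ZMod q)) : 0 ≤ lightWeight α Y :=
  Finset.sum_nonneg fun i _ => Finset.sum_nonneg fun k _ => by
    split_ifs <;> simp [entryIndicator_nonneg]

lemma heavyWeight_nonneg (α : ℝ) (Y : Matrix (Fin n) (Fin n) (ZMod q)) : 0 ≤ heavyWeight α Y :=
  Finset.sum_nonneg fun i _ => Finset.sum_nonneg fun k _ => by
    split_ifs <;> simp [entryIndicator_nonneg]

lemma card_heavyRows_le (α : ℝ) (Y : Matrix (Fin n) (Fin n) (ZMod q)) :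
    α * n * (heavyRows α Y).card ≤ heavyWeight α Y := by
  calc α * n * (heavyRows α Y).card = ∑ i ∈ heavyRows α Y, α * n := by
        rw [Finset.sum_const, nsmul_eq_mul, mul_comm]
    _ ≤ ∑ i ∈ heavyRows α Y, ∑ k, (if i ∈ heavyRows α Y ∨ k ∈ heavyCols α Y
          then entryIndicator Y i k else 0) := by
        refine Finset.sum_le_sum fun i hi => ?_
        simp only [hi, true_or, if_true]
        exact (Finset.mem_filter.1 hi).2.le
    _ ≤ _ := Finset.sum_le_sum_of_subset_of_nonneg (Finset.subset_univ _) fun i _ _ =>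
        Finset.sum_nonneg fun k _ => by split_ifs <;> simp [entryIndicator_nonneg]

lemma card_heavyCols_le (α : ℝ) (Y : Matrix (Fin n) (Fin n) (ZMod q)) :
    α * n * (heavyCols α Y).card ≤ heavyWeight α Y := by
  rw [heavyWeight, Finset.sum_comm]
  calc α * n * (heavyCols α Y).card = ∑ k ∈ heavyCols α Y, α * n := by
        rw [Finset.sum_const, nsmul_eq_mul, mul_comm]
    _ ≤ ∑ k ∈ heavyCols α Y, ∑ i, (if i ∈ heavyRows α Y ∨ k ∈ heavyCols α Y
          then entryIndicator Y i k else 0) := by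
        refine Finset.sum_le_sum fun i hi => ?_
        simp only [hi, or_true, if_true]
        exact (Finset.mem_filter.1 hi).2.le
    _ ≤ _ := Finset.sum_le_sum_of_subset_of_nonneg (Finset.subset_univ _) fun i _ _ =>
        Finset.sum_nonneg fun k _ => by split_ifs <;> simp [entryIndicator_nonneg]

/-- For fixed `j` and `l`, the corner sums of `Y` are, up to sign, the entries of a matrix in the
class of `Y`; by minimality at least `tableWeight Y` of them are nonzero. -/
lemma sq_mul_tableWeight_le_rectCount [NeZero q] {Y : Matrix (Fin n) (Fin n) (ZMod q)}
    (hY : IsMinimalTable Y) : (n : ℝ) ^ 2 * tableWeight Y ≤ rectCount Y := by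
  have hswap : rectCount Y
      = ∑ j, ∑ l, ∑ i, ∑ k, if rectDiff Y i j k l = 0 then (0 : ℝ) else 1 := by
    rw [rectCount, Finset.sum_comm]
    refine Finset.sum_congr rfl fun j _ => ?_
    rw [Finset.sum_congr rfl fun i _ => Finset.sum_comm, Finset.sum_comm]
  rw [hswap]
  calc (n : ℝ) ^ 2 * tableWeight Y = ∑ j : Fin n, ∑ l : Fin n, (tableWeight Y : ℝ) := by
        simp; ring
    _ ≤ _ := by
        refine Finset.sum_le_sum fun j _ => Finset.sum_le_sum fun l _ => ?_
        set Z : Matrix (Fin n) (Fin n) (ZMod q) :=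
          Matrix.of fun i k => Y j l - Y i l - Y j k with hZ
        have h := hY Z (fun a b c d => by simp only [hZ, rectDiff, Matrix.of_apply]; ring)
        have h' : (tableWeight Y : ℝ) ≤ tableWeight (Y + Z) := by exact_mod_cast h
        rw [tableWeight_eq_sum (Y + Z)] at h'
        refine h'.trans (le_of_eq ?_)
        refine Finset.sum_congr rfl fun i _ => Finset.sum_congr rfl fun k _ => ?_
        rw [entryIndicator, show (Y + Z) i k = -rectDiff Y i j k l by
          simp only [hZ, rectDiff, Matrix.of_apply, Matrix.add_apply]; ring]
        simp only [neg_eq_zero]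

/-- The indicator that `(i, k)` is the only corner of a rectangle with a non-zero entry. -/
def cornerIndicator (Y : Matrix (Fin n) (Fin n) (ZMod q)) (i j k l : Fin n) : ℝ :=
  entryIndicator Y i k * ((1 - entryIndicator Y i l) * (1 - entryIndicator Y j k)
    * (1 - entryIndicator Y j l))

lemma cornerIndicator_nonneg (Y : Matrix (Fin n) (Fin n) (ZMod q)) (i j k l : Fin n) :
    0 ≤ cornerIndicator Y i j k l := by
  have h := fun i k => sub_nonneg.2 (entryIndicator_le_one Y i k)
  exact mul_nonneg (entryIndicator_nonneg _ _ _)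
    (mul_nonneg (mul_nonneg (h _ _) (h _ _)) (h _ _))

/-- At most one corner can be the only nonzero one, and then the corner sum is plus or minus that
entry. -/
lemma sum_cornerIndicator_le (Y : Matrix (Fin n) (Fin n) (ZMod q)) (i j k l : Fin n) :
    cornerIndicator Y i j k l + cornerIndicator Y i j l k + cornerIndicator Y j i k l
      + cornerIndicator Y j i l k ≤ if rectDiff Y i j k l = 0 then 0 else 1 := by
  unfold cornerIndicator entryIndicator rectDiff
  by_cases h1 : Y i k = 0 <;> by_cases h2 : Y i l = 0 <;> by_cases h3 : Y j k = 0 <;>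
    by_cases h4 : Y j l = 0 <;> simp [h1, h2, h3, h4] <;> split_ifs <;> norm_num

lemma four_mul_sum_cornerIndicator_le_rectCount [NeZero q]
    (Y : Matrix (Fin n) (Fin n) (ZMod q)) :
    4 * ∑ i, ∑ j, ∑ k, ∑ l, cornerIndicator Y i j k l ≤ rectCount Y := by
  set S := ∑ i, ∑ j, ∑ k, ∑ l, cornerIndicator Y i j k l with hS
  have h2 : ∑ i, ∑ j, ∑ k, ∑ l, cornerIndicator Y i j l k = S :=
    Finset.sum_congr rfl fun i _ => Finset.sum_congr rfl fun j _ => Finset.sum_comm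
  have h3 : ∑ i, ∑ j, ∑ k, ∑ l, cornerIndicator Y j i k l = S := Finset.sum_comm
  have h4 : ∑ i, ∑ j, ∑ k, ∑ l, cornerIndicator Y j i l k = S := by
    rw [Finset.sum_comm, ← h2]
  calc 4 * S = S + S + S + S := by ring
    _ = ∑ i, ∑ j, ∑ k, ∑ l, (cornerIndicator Y i j k l + cornerIndicator Y i j l k
          + cornerIndicator Y j i k l + cornerIndicator Y j i l k) := by
        simp only [Finset.sum_add_distrib]
        rw [h2, h3, h4]
    _ ≤ _ := Finset.sum_le_sum fun i _ => Finset.sum_le_sum fun j _ =>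
        Finset.sum_le_sum fun k _ => Finset.sum_le_sum fun l _ => sum_cornerIndicator_le Y i j k l

/-- For a light entry `(i, k)` there are at least `(n (1 - α)) ^ 2` choices of `(j, l)` with zeros
at `(j, k)` and `(i, l)`. At most `tableWeight Y` of them are spoilt by a nonzero entry at `(j, l)`.
-/
lemma four_mul_lightWeight_mul_le_rectCount [NeZero q] {α : ℝ} (hα : α ≤ 1)
    (Y : Matrix (Fin n) (Fin n) (ZMod q)) :
    4 * lightWeight α Y * ((n : ℝ) ^ 2 * (1 - α) ^ 2 - tableWeight Y) ≤ rectCount Y := by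
  refine le_trans ?_ (four_mul_sum_cornerIndicator_le_rectCount Y)
  rw [mul_assoc]
  refine mul_le_mul_of_nonneg_left ?_ (by norm_num)
  rw [lightWeight, Finset.sum_mul]
  refine Finset.sum_le_sum fun i _ => ?_
  rw [Finset.sum_mul, Finset.sum_comm]
  refine Finset.sum_le_sum fun k _ => ?_
  split_ifs with h
  · rw [zero_mul]
    exact Finset.sum_nonneg fun j _ => Finset.sum_nonneg fun l _ => cornerIndicator_nonneg _ _ _ _ _
  · simp only [heavyRows, heavyCols, Finset.mem_filter, Finset.mem_univ, true_and, not_or,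
      not_lt] at h
    obtain ⟨hr, hc⟩ := h
    simp only [cornerIndicator, ← Finset.mul_sum]
    refine mul_le_mul_of_nonneg_left ?_ (entryIndicator_nonneg _ _ _)
    have hn : (0 : ℝ) ≤ n := Nat.cast_nonneg n
    calc (n : ℝ) ^ 2 * (1 - α) ^ 2 - tableWeight Y
        ≤ (n - ∑ j, entryIndicator Y j k) * (n - ∑ l, entryIndicator Y i l)
            - tableWeight Y := by
          have h1 : (n : ℝ) * (1 - α) ≤ n - ∑ j, entryIndicator Y j k := by linarith
          have h2 : (n : ℝ) * (1 - α) ≤ n - ∑ l, entryIndicator Y i l := by linarith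
          have h3 : 0 ≤ (n : ℝ) * (1 - α) := mul_nonneg hn (by linarith)
          have := mul_le_mul h1 h2 h3 (h3.trans h1)
          nlinarith
      _ = ∑ j, ∑ l, ((1 - entryIndicator Y j k) * (1 - entryIndicator Y i l)
            - entryIndicator Y j l) := by
          simp only [Finset.sum_sub_distrib, ← Finset.mul_sum, ← Finset.sum_mul]
          rw [tableWeight_eq_sum]
          simp
      _ ≤ _ := by
          refine Finset.sum_le_sum fun j _ => Finset.sum_le_sum fun l _ => ?_
          have a1 := entryIndicator_nonneg Y j k
          have a2 := entryIndicator_nonneg Y i l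
          have a3 := entryIndicator_nonneg Y j l
          have b1 := entryIndicator_le_one Y j k
          have b2 := entryIndicator_le_one Y i l
          have hp : (1 - entryIndicator Y j k) * (1 - entryIndicator Y i l) ≤ 1 := by nlinarith
          nlinarith

end Weights

/-! ### Weighted enumeration of matrices -/

section Counting

variable {n q : ℕ} [NeZero q]

lemma sum_prod_prod_matrix (G : Fin n → Fin n → ZMod q → ℝ) :
    ∑ Y : Matrix (Fin n) (Fin n) (ZMod q), ∏ i, ∏ j, G i j (Y i j)
      = ∏ i, ∏ j, ∑ y, G i j y := by
  simp_rw [Finset.prod_univ_sum, Fintype.piFinset_univ]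
  rfl

lemma sum_ite_zero_le_exp {c : ℝ} (hc : 0 ≤ c) :
    ∑ y : ZMod q, (if y = 0 then 1 else c) ≤ Real.exp (q * c) := by
  calc ∑ y : ZMod q, (if y = 0 then 1 else c)
      ≤ ∑ y : ZMod q, ((if y = 0 then 1 else 0) + c) :=
        Finset.sum_le_sum fun y _ => by split_ifs <;> simp [hc]
    _ = q * c + 1 := by simp [Finset.sum_add_distrib, ZMod.card]; ring
    _ ≤ _ := Real.add_one_le_exp _

lemma sum_exp_neg_mul_card_le {β : ℝ} :
    ∑ R : Finset (Fin n), Real.exp (-(β * R.card)) ≤ Real.exp (n * Real.exp (-β)) := by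
  have h := Fintype.sum_pow_mul_eq_add_pow (Fin n) (Real.exp (-β)) 1
  simp only [one_pow, mul_one, Fintype.card_fin, ← Real.exp_nat_mul] at h
  calc _ = (Real.exp (-β) + 1) ^ n := by
        rw [← h]; exact Finset.sum_congr rfl fun R _ => by congr 1; ring
    _ ≤ (Real.exp (Real.exp (-β))) ^ n :=
        pow_le_pow_left₀ (by positivity) (Real.add_one_le_exp _) n
    _ = _ := by rw [← Real.exp_nat_mul]

/-- The total mass of all matrices, where every light non-zero entry costs `exp (-a)` and every
heavy one `exp (-b)`. -/
lemma sum_exp_lightWeight_heavyWeight_le {a b α : ℝ} (hb : 0 ≤ b)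
    (hab : q * Real.exp (-(b / 2)) ≤ α * b / 8) :
    ∑ Y : Matrix (Fin n) (Fin n) (ZMod q), Real.exp (-(a * lightWeight α Y + b * heavyWeight α Y))
      ≤ Real.exp ((n : ℝ) ^ 2 * q * Real.exp (-a)
          + 2 * (n * Real.exp (-(b * α * n / 8)))) := by
  classical
  set c : Finset (Fin n) → Finset (Fin n) → Fin n → Fin n → ℝ := fun R S i j =>
    if i ∈ R ∨ j ∈ S then Real.exp (-(b / 2)) else Real.exp (-a) with hc
  have hc0 : ∀ R S i j, 0 ≤ c R S i j := fun R S i j => by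
    simp only [hc]; split_ifs <;> positivity
  -- `R` and `S` are guesses for the heavy rows and columns. Half of the heavy cost stays on the
  -- entries; the other half pays `b α n / 4` for each guessed line, since heavy lines contain more
  -- than `α n` entries.
  set W : Finset (Fin n) → Finset (Fin n) → Matrix (Fin n) (Fin n) (ZMod q) → ℝ := fun R S Y =>
    Real.exp (-(b * α * n / 4 * R.card)) * Real.exp (-(b * α * n / 4 * S.card))
      * ∏ i, ∏ j, (if Y i j = 0 then 1 else c R S i j) with hW
  have hW0 : ∀ R S Y, 0 ≤ W R S Y := fun R S Y => by
    simp only [hW]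
    refine mul_nonneg (by positivity) (Finset.prod_nonneg fun i _ => Finset.prod_nonneg fun j _ => ?_)
    split_ifs
    · norm_num
    · exact hc0 _ _ _ _
  have hpoint : ∀ Y, Real.exp (-(a * lightWeight α Y + b * heavyWeight α Y))
      ≤ W (heavyRows α Y) (heavyCols α Y) Y := by
    intro Y
    have hprod : ∏ i, ∏ j, (if Y i j = 0 then 1 else c (heavyRows α Y) (heavyCols α Y) i j)
        = Real.exp (-(a * lightWeight α Y + b / 2 * heavyWeight α Y)) := by
      rw [lightWeight, heavyWeight, Finset.mul_sum, Finset.mul_sum, ← Finset.sum_add_distrib,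
        ← Finset.sum_neg_distrib, Real.exp_sum]
      refine Finset.prod_congr rfl fun i _ => ?_
      rw [Finset.mul_sum, Finset.mul_sum, ← Finset.sum_add_distrib, ← Finset.sum_neg_distrib,
        Real.exp_sum]
      refine Finset.prod_congr rfl fun j _ => ?_
      simp only [hc, entryIndicator]
      split_ifs <;> simp
    simp only [hW]
    rw [hprod, ← Real.exp_add, ← Real.exp_add, Real.exp_le_exp]
    have h1 := mul_le_mul_of_nonneg_left (card_heavyRows_le α Y) hb
    have h2 := mul_le_mul_of_nonneg_left (card_heavyCols_le α Y) hb
    linarith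
  have hRS : ∀ R S, ∑ Y, W R S Y ≤ Real.exp ((n : ℝ) ^ 2 * q * Real.exp (-a))
      * (Real.exp (-(b * α * n / 8 * R.card)) * Real.exp (-(b * α * n / 8 * S.card))) := by
    intro R S
    simp only [hW]
    rw [← Finset.mul_sum, sum_prod_prod_matrix (fun i j y => if y = 0 then 1 else c R S i j)]
    have h1 : ∏ i, ∏ j, ∑ y : ZMod q, (if y = 0 then 1 else c R S i j)
        ≤ Real.exp (∑ i, ∑ j, q * c R S i j) := by
      simp_rw [Real.exp_sum]
      refine Finset.prod_le_prod (fun i _ => ?_) fun i _ => ?_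
      · exact Finset.prod_nonneg fun j _ => Finset.sum_nonneg fun y _ => by
          split_ifs
          · norm_num
          · exact hc0 _ _ _ _
      · refine Finset.prod_le_prod (fun j _ => ?_) fun j _ => sum_ite_zero_le_exp (hc0 _ _ _ _)
        exact Finset.sum_nonneg fun y _ => by
          split_ifs
          · norm_num
          · exact hc0 _ _ _ _
    have h2 : ∑ i, ∑ j, q * c R S i j ≤ (n : ℝ) ^ 2 * q * Real.exp (-a)
        + (n * R.card + n * S.card) * (q * Real.exp (-(b / 2))) := by
      calc ∑ i, ∑ j, q * c R S i j
          ≤ ∑ i, ∑ j, (q * Real.exp (-a) + ((if i ∈ R then 1 else 0) + if j ∈ S then 1 else 0)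
              * (q * Real.exp (-(b / 2)))) := by
            refine Finset.sum_le_sum fun i _ => Finset.sum_le_sum fun j _ => ?_
            have e1 : 0 ≤ q * Real.exp (-a) := by positivity
            have e2 : 0 ≤ q * Real.exp (-(b / 2)) := by positivity
            simp only [hc]
            by_cases hi : i ∈ R <;> by_cases hj : j ∈ S <;> simp [hi, hj] <;> linarith
        _ = _ := by
            simp only [Finset.sum_add_distrib, ← Finset.sum_mul]
            simp
            ring
    -- The cells of the guessed lines use up half of what each line pays, leaving `b α n / 8` per
    -- line.
    have h3 : (n * R.card + n * S.card) * (q * Real.exp (-(b / 2)))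
        ≤ ((n : ℝ) * R.card + n * S.card) * (α * b / 8) :=
      mul_le_mul_of_nonneg_left hab (by positivity)
    calc _ ≤ Real.exp (-(b * α * n / 4 * R.card)) * Real.exp (-(b * α * n / 4 * S.card))
          * Real.exp (∑ i, ∑ j, q * c R S i j) := mul_le_mul_of_nonneg_left h1 (by positivity)
      _ ≤ _ := by
          simp only [← Real.exp_add]
          rw [Real.exp_le_exp]
          linarith
  calc ∑ Y, Real.exp (-(a * lightWeight α Y + b * heavyWeight α Y))
      ≤ ∑ Y, ∑ R, ∑ S, W R S Y := by
        refine Finset.sum_le_sum fun Y _ => (hpoint Y).trans ?_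
        refine le_trans ?_ (Finset.single_le_sum (f := fun R => ∑ S, W R S Y)
          (fun R _ => Finset.sum_nonneg fun S _ => hW0 _ _ _) (Finset.mem_univ (heavyRows α Y)))
        exact Finset.single_le_sum (f := fun S => W (heavyRows α Y) S Y)
          (fun S _ => hW0 _ _ _) (Finset.mem_univ (heavyCols α Y))
    _ = ∑ R, ∑ S, ∑ Y, W R S Y := by
        rw [Finset.sum_comm]
        exact Finset.sum_congr rfl fun R _ => Finset.sum_comm
    _ ≤ ∑ R : Finset (Fin n), ∑ S : Finset (Fin n), Real.exp ((n : ℝ) ^ 2 * q * Real.exp (-a))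
      * (Real.exp (-(b * α * n / 8 * R.card)) * Real.exp (-(b * α * n / 8 * S.card))) :=
        Finset.sum_le_sum fun R _ => Finset.sum_le_sum fun S _ => hRS R S
    _ = Real.exp ((n : ℝ) ^ 2 * q * Real.exp (-a))
      * ((∑ R : Finset (Fin n), Real.exp (-(b * α * n / 8 * R.card)))
        * ∑ S : Finset (Fin n), Real.exp (-(b * α * n / 8 * S.card))) := by
        rw [Finset.sum_mul_sum, Finset.mul_sum]
        exact Finset.sum_congr rfl fun R _ => by rw [Finset.mul_sum]
    _ ≤ Real.exp ((n : ℝ) ^ 2 * q * Real.exp (-a))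
      * (Real.exp (n * Real.exp (-(b * α * n / 8))) * Real.exp (n * Real.exp (-(b * α * n / 8)))) := by
        refine mul_le_mul_of_nonneg_left ?_ (by positivity)
        exact mul_le_mul sum_exp_neg_mul_card_le sum_exp_neg_mul_card_le
          (Finset.sum_nonneg fun _ _ => by positivity) (by positivity)
    _ = _ := by
        rw [← Real.exp_add, ← Real.exp_add]
        congr 1
        ring

/-- The total mass of all matrices, where every non-zero entry costs `exp (-a)`. -/
lemma sum_exp_tableWeight_le {a : ℝ} :
    ∑ Y : Matrix (Fin n) (Fin n) (ZMod q), Real.exp (-(a * tableWeight Y))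
      ≤ Real.exp ((n : ℝ) ^ 2 * q * Real.exp (-a)) := by
  have hprod : ∀ Y : Matrix (Fin n) (Fin n) (ZMod q), Real.exp (-(a * tableWeight Y))
      = ∏ i, ∏ j, if Y i j = 0 then 1 else Real.exp (-a) := by
    intro Y
    rw [tableWeight_eq_sum]
    simp only [Finset.mul_sum, ← Finset.sum_neg_distrib, Real.exp_sum, entryIndicator]
    refine Finset.prod_congr rfl fun i _ => Finset.prod_congr rfl fun j _ => ?_
    split_ifs <;> simp
  rw [Finset.sum_congr rfl fun Y _ => hprod Y,
    sum_prod_prod_matrix (fun _ _ y => if y = 0 then 1 else Real.exp (-a))]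
  calc _ ≤ ∏ i : Fin n, ∏ j : Fin n, Real.exp (q * Real.exp (-a)) := by
        have h0 : 0 ≤ ∑ y : ZMod q, (if y = 0 then 1 else Real.exp (-a)) :=
          Finset.sum_nonneg fun y _ => by split_ifs <;> positivity
        exact Finset.prod_le_prod (fun i _ => Finset.prod_nonneg fun j _ => h0) fun i _ =>
          Finset.prod_le_prod (fun j _ => h0) fun j _ => sum_ite_zero_le_exp (by positivity)
    _ = _ := by
        simp only [Finset.prod_const, Finset.card_univ, Fintype.card_fin, ← Real.exp_nat_mul]
        congr 1
        ring

end Counting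

/-! ### The upper bound on the distance -/

section UpperBound

variable {n q : ℕ} [NeZero q]

/-- For `λ ≥ 0` the second term comes from `λ ≤ exp (-(1 - λ))`; for `λ ≤ 0` the first one comes
from `λ ^ 2 ≤ 1 / 9 ≤ exp (-2)`. -/
lemma walkEigenvalue_sq_pow_le (hn : 4 ≤ n) {t : ℕ} {V : ℝ}
    (hV : V * (n : ℝ) ^ 2 = 2 * t * (1 - Real.cos (2 * Real.pi / q)))
    (Y : Matrix (Fin n) (Fin n) (ZMod q)) :
    (walkEigenvalue Y ^ 2) ^ t
      ≤ Real.exp (-(2 * t)) + Real.exp (-(V * (rectCount Y / (n : ℝ) ^ 2))) := by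
  set x := walkEigenvalue Y with hx
  have hn0 : (0 : ℝ) < n := by exact_mod_cast (by omega : 0 < n)
  have h1 := rectCount_le_one_sub_walkEigenvalue (by omega) Y
  have h2 := neg_one_third_le_walkEigenvalue hn Y
  have h3 : V * (rectCount Y / (n : ℝ) ^ 2) ≤ t * (2 * (1 - x)) := by
    have hVe : V = 2 * t * (1 - Real.cos (2 * Real.pi / q)) / (n : ℝ) ^ 2 := by
      field_simp; linarith
    have : V * (rectCount Y / (n : ℝ) ^ 2)
        = 2 * t * ((1 - Real.cos (2 * Real.pi / q)) * rectCount Y) / (n : ℝ) ^ 4 := by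
      rw [hVe]; field_simp
    rw [this, div_le_iff₀ (by positivity)]
    have := mul_le_mul_of_nonneg_left h1 (by positivity : (0 : ℝ) ≤ 2 * t)
    linarith
  rcases le_total 0 x with hx0 | hx0
  · have h4 : x ≤ Real.exp (-(1 - x)) := by
      have := Real.add_one_le_exp (-(1 - x))
      linarith
    have h5 : (x ^ 2) ^ t ≤ Real.exp (-(t * (2 * (1 - x)))) := by
      calc (x ^ 2) ^ t ≤ (Real.exp (-(1 - x)) ^ 2) ^ t :=
            pow_le_pow_left₀ (sq_nonneg x) (pow_le_pow_left₀ hx0 h4 2) t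
        _ = _ := by
            rw [← Real.exp_nat_mul, ← Real.exp_nat_mul]
            congr 1
            push_cast
            ring
    have h6 := Real.exp_le_exp.2 (neg_le_neg h3)
    have := Real.exp_pos (-(2 * (t : ℝ)))
    linarith
  · have h4 : x ^ 2 ≤ Real.exp (-2) := by
      have he : Real.exp 2 ≤ 9 := by
        have := Real.exp_one_lt_d9
        have h0 := Real.exp_pos 1
        rw [show (2 : ℝ) = 1 + 1 by norm_num, Real.exp_add]
        nlinarith
      rw [Real.exp_neg]
      have : (9 : ℝ)⁻¹ ≤ (Real.exp 2)⁻¹ := inv_anti₀ (Real.exp_pos 2) he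
      nlinarith
    have h5 : (x ^ 2) ^ t ≤ Real.exp (-(2 * t)) := by
      calc (x ^ 2) ^ t ≤ Real.exp (-2) ^ t := pow_le_pow_left₀ (sq_nonneg x) h4 t
        _ = _ := by rw [← Real.exp_nat_mul]; congr 1; ring
    have := Real.exp_pos (-(V * (rectCount Y / (n : ℝ) ^ 2)))
    linarith

lemma exp_sub_one_le_two_mul {x : ℝ} (h0 : 0 ≤ x) (h1 : x ≤ 1 / 2) : Real.exp x - 1 ≤ 2 * x := by
  have h := Real.add_one_le_exp (-x)
  have h2 : Real.exp x * Real.exp (-x) = 1 := by rw [← Real.exp_add]; simp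
  have h3 := Real.exp_pos x
  have h4 : Real.exp x * (1 - x) ≤ 1 := by nlinarith
  by_contra! h5
  nlinarith

lemma card_filter_mul_exp_le (P : Matrix (Fin n) (Fin n) (ZMod q) → Prop) [DecidablePred P]
    (s : ℝ) :
    ∑ _Y ∈ Finset.univ.filter P, Real.exp (-s) ≤ Real.exp ((n : ℝ) ^ 2 * Real.log q - s) := by
  have hq : (0 : ℝ) < q := by exact_mod_cast Nat.pos_of_ne_zero (NeZero.ne q)
  rw [Finset.sum_const, nsmul_eq_mul, sub_eq_add_neg, Real.exp_add]
  refine mul_le_mul_of_nonneg_right ?_ (by positivity)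
  have h1 : ((Finset.univ.filter P).card : ℝ) ≤ Fintype.card (Matrix (Fin n) (Fin n) (ZMod q)) := by
    exact_mod_cast Finset.card_le_univ _
  refine h1.trans (le_of_eq ?_)
  have h2 : Fintype.card (Matrix (Fin n) (Fin n) (ZMod q)) = q ^ (n ^ 2) := by
    have : Fintype.card (Fin n → Fin n → ZMod q) = q ^ (n ^ 2) := by
      simp [ZMod.card, ← pow_mul, sq]
    exact this
  rw [h2]
  push_cast
  rw [← Real.exp_log hq, ← Real.exp_nat_mul, Real.log_exp]
  push_cast
  rfl

open Classical in
lemma sum_filter_not_isAdditiveTable_le (f : Matrix (Fin n) (Fin n) (ZMod q) → ℝ)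
    (hf : ∀ Y, 0 ≤ f Y) (h0 : f 0 = 1) :
    ∑ Y ∈ Finset.univ.filter (fun Y : Matrix (Fin n) (Fin n) (ZMod q) =>
        ¬ IsAdditiveTable Y ∧ IsMinimalTable Y), f Y ≤ ∑ Y, f Y - 1 := by
  rw [← h0, ← Finset.sum_erase_eq_sub (Finset.mem_univ _)]
  refine Finset.sum_le_sum_of_subset_of_nonneg (fun Y hY => ?_) fun Y _ _ => hf Y
  rw [Finset.mem_erase]
  refine ⟨?_, Finset.mem_univ _⟩
  rintro rfl
  exact (Finset.mem_filter.1 hY).2.1 fun i j k l => by simp [rectDiff]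

/-- Lower bound for the decay rate of a minimal matrix when `n` is huge. -/
lemma decay_rate_ge {Y : Matrix (Fin n) (Fin n) (ZMod q)} (hn : 1 ≤ n) (hY : IsMinimalTable Y)
    {L K V : ℝ} (hL : 50 ≤ L) (hK : 440 ≤ K) (hV : L ^ 2 / 2 + 2 * K * L ≤ V)
    (hw : (tableWeight Y : ℝ) ≤ (n : ℝ) ^ 2 / L) :
    (2 * L ^ 2 + 6 * K * L) * lightWeight (1 / L) Y + (5 * L + 20 * K) * heavyWeight (1 / L) Y
      ≤ V * (rectCount Y / (n : ℝ) ^ 2) := by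
  have hL0 : 0 < L := by linarith
  have hn0 : (0 : ℝ) < (n : ℝ) ^ 2 := by positivity
  set r := rectCount Y / (n : ℝ) ^ 2 with hr
  set u := lightWeight (1 / L) Y
  set v := heavyWeight (1 / L) Y
  have hu : 0 ≤ u := lightWeight_nonneg _ _
  have hv : 0 ≤ v := heavyWeight_nonneg _ _
  have huv : u + v = tableWeight Y := lightWeight_add_heavyWeight _ _
  have hη : 1 / L ≤ 1 / 50 := one_div_le_one_div_of_le (by norm_num) hL
  have hη0 : 0 < 1 / L := by positivity
  set η := 1 / L with hηd
  have hηL : η * L = 1 := by rw [hηd]; field_simp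
  have h1 : u + v ≤ r := by
    rw [huv, hr, le_div_iff₀ hn0, mul_comm]
    exact sq_mul_tableWeight_le_rectCount hY
  have h2 : 4 * u * (1 - 3 * η) ≤ r := by
    rw [hr, le_div_iff₀ hn0]
    refine le_trans ?_ (four_mul_lightWeight_mul_le_rectCount (α := η) (by linarith) Y)
    rw [mul_assoc]
    refine mul_le_mul_of_nonneg_left ?_ (by linarith)
    have hw' : (tableWeight Y : ℝ) ≤ (n : ℝ) ^ 2 * η := by
      rw [hηd, mul_one_div]; exact hw
    nlinarith [mul_nonneg hn0.le (sq_nonneg η)]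
  -- A convex combination of the two lower bounds for `r`. The weight `10 η` leaves heavy entries
  -- the rate `10 η (L ^ 2 / 2 + 2 K L) = 5 L + 20 K`; light entries lose only a term of order `η`.
  have h3 : (1 - 10 * η) * (4 * u * (1 - 3 * η)) + 10 * η * (u + v) ≤ r := by
    have e1 := mul_le_mul_of_nonneg_left h2 (by linarith : 0 ≤ 1 - 10 * η)
    have e2 := mul_le_mul_of_nonneg_left h1 (by linarith : 0 ≤ 10 * η)
    linarith
  have h4 : (4 - 42 * η) * u + 10 * η * v ≤ r := by
    have : 0 ≤ u * η ^ 2 := by positivity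
    nlinarith
  have hpos : 0 ≤ (4 - 42 * η) * u + 10 * η * v := by
    have : 0 ≤ (4 - 42 * η) * u := mul_nonneg (by linarith) hu
    positivity
  have hKL : 0 ≤ K * L := by positivity
  have h5 : (L ^ 2 / 2 + 2 * K * L) * ((4 - 42 * η) * u + 10 * η * v) ≤ V * r :=
    mul_le_mul hV h4 hpos (le_trans (by positivity) hV)
  refine le_trans (le_of_sub_nonneg ?_) h5
  have hid : (L ^ 2 / 2 + 2 * K * L) * ((4 - 42 * η) * u + 10 * η * v)
      - ((2 * L ^ 2 + 6 * K * L) * u + (5 * L + 20 * K) * v)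
      = (2 * K * L - 21 * L - 84 * K) * u := by
    linear_combination (-(21 * L * u) - 84 * K * u + 5 * L * v + 20 * K * v) * hηL
  rw [hid]
  exact mul_nonneg (by nlinarith) hu

-- For bounded `L` the rate `V` per nonzero entry suffices: `n ^ 2 q exp (-V)` is at most `exp (3 L
-- ^ 2 / 2 + l - 2 K L)`, and the large `K` dominates.
open Classical in
lemma sum_exp_rate_le_of_le_fifty {l L K V : ℝ} (hnexp : (n : ℝ) = Real.exp (L ^ 2))
    (hqexp : (q : ℝ) = Real.exp l)
    (hlK : 640 * l ≤ K) (hK : 440 ≤ K) (hL1 : 1.17 ≤ L) (hL50 : L ≤ 50)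
    (hV : L ^ 2 / 2 + 2 * K * L ≤ V) :
    ∑ Y ∈ Finset.univ.filter
      (fun Y : Matrix (Fin n) (Fin n) (ZMod q) => ¬ IsAdditiveTable Y ∧ IsMinimalTable Y),
      Real.exp (-(V * (rectCount Y / (n : ℝ) ^ 2))) ≤ 3 * Real.exp (-(2 * K)) := by
  have hn0 : (0 : ℝ) < n := by rw [hnexp]; positivity
  have hKL : 0 ≤ K * L := mul_nonneg (by linarith) (by linarith)
  have hV0 : 0 ≤ V := le_trans (by nlinarith) hV
  have hsmall : Real.exp (-(2 * K)) ≤ 1 / 4 := by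
    have := Real.add_one_le_exp (2 * K)
    rw [Real.exp_neg, inv_eq_one_div]
    exact one_div_le_one_div_of_le (by norm_num) (by linarith)
  have hbound : ∑ Y ∈ Finset.univ.filter
      (fun Y : Matrix (Fin n) (Fin n) (ZMod q) => ¬ IsAdditiveTable Y ∧ IsMinimalTable Y),
      Real.exp (-(V * (rectCount Y / (n : ℝ) ^ 2)))
      ≤ Real.exp ((n : ℝ) ^ 2 * q * Real.exp (-V)) - 1 := by
    calc _ ≤ ∑ Y ∈ Finset.univ.filter
          (fun Y : Matrix (Fin n) (Fin n) (ZMod q) => ¬ IsAdditiveTable Y ∧ IsMinimalTable Y),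
          Real.exp (-(V * tableWeight Y)) := by
          refine Finset.sum_le_sum fun Y hY => Real.exp_le_exp.2 (neg_le_neg ?_)
          refine mul_le_mul_of_nonneg_left ?_ hV0
          rw [le_div_iff₀ (by positivity), mul_comm]
          exact sq_mul_tableWeight_le_rectCount (Finset.mem_filter.1 hY).2.2
      _ ≤ ∑ Y, Real.exp (-(V * tableWeight Y)) - 1 :=
          sum_filter_not_isAdditiveTable_le (fun Y => Real.exp (-(V * tableWeight Y)))
            (fun Y => by positivity) (by simp [tableWeight])
      _ ≤ _ := sub_le_sub_right sum_exp_tableWeight_le 1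
  have hX : (n : ℝ) ^ 2 * q * Real.exp (-V) ≤ Real.exp (-(2 * K)) := by
    rw [hnexp, hqexp, ← Real.exp_nat_mul, ← Real.exp_add, ← Real.exp_add]
    apply Real.exp_le_exp.2
    push_cast
    nlinarith
  have h1 := exp_sub_one_le_two_mul (x := (n : ℝ) ^ 2 * q * Real.exp (-V)) (by positivity)
    (by linarith)
  linarith [Real.exp_pos (-(2 * K))]

open Classical in
lemma sum_exp_rate_le_of_fifty_le {l L K V : ℝ} (hn : 4 ≤ n) (hnexp : (n : ℝ) = Real.exp (L ^ 2))
    (hqexp : (q : ℝ) = Real.exp l) (hl0 : 0.69 ≤ l)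
    (hlK : 640 * l ≤ K) (hK : 440 ≤ K) (hL50 : 50 ≤ L)
    (hV : L ^ 2 / 2 + 2 * K * L ≤ V) :
    ∑ Y ∈ Finset.univ.filter
      (fun Y : Matrix (Fin n) (Fin n) (ZMod q) => ¬ IsAdditiveTable Y ∧ IsMinimalTable Y),
      Real.exp (-(V * (rectCount Y / (n : ℝ) ^ 2))) ≤ 3 * Real.exp (-(2 * K)) := by
  have hn' : (4 : ℝ) ≤ n := by exact_mod_cast hn
  have hn0 : (0 : ℝ) < n := by linarith
  have hn2 : (16 : ℝ) ≤ (n : ℝ) ^ 2 := by nlinarith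
  have hL2 : L ^ 2 = Real.log n := by rw [hnexp, Real.log_exp]
  have hlq : l = Real.log q := by rw [hqexp, Real.log_exp]
  have hKL : 0 ≤ K * L := mul_nonneg (by linarith) (by linarith)
  have hV0 : 0 ≤ V := le_trans (by nlinarith) hV
  have hsmall : Real.exp (-(2 * K)) ≤ 1 / 4 := by
    have := Real.add_one_le_exp (2 * K)
    rw [Real.exp_neg, inv_eq_one_div]
    exact one_div_le_one_div_of_le (by norm_num) (by linarith)
  have hL0 : 0 < L := by linarith
  have hpoint : ∀ Y : Matrix (Fin n) (Fin n) (ZMod q), IsMinimalTable Y →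
      Real.exp (-(V * (rectCount Y / (n : ℝ) ^ 2))) ≤ Real.exp (-(2 * K * (n : ℝ) ^ 2))
        + Real.exp (-((2 * L ^ 2 + 6 * K * L) * lightWeight (1 / L) Y
          + (5 * L + 20 * K) * heavyWeight (1 / L) Y)) := by
    intro Y hY
    -- Sparse matrices use the interpolated rate. Dense ones decay by `2 K n ^ 2`, more than the
    -- entropy `n ^ 2 l` of all matrices.
    rcases le_total (tableWeight Y : ℝ) ((n : ℝ) ^ 2 / L) with hw | hw
    · have := Real.exp_le_exp.2 (neg_le_neg (decay_rate_ge (by omega) hY hL50 hK hV hw))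
      linarith [Real.exp_pos (-(2 * K * (n : ℝ) ^ 2))]
    · have h1 : (n : ℝ) ^ 2 / L ≤ rectCount Y / (n : ℝ) ^ 2 := by
        refine hw.trans ?_
        rw [le_div_iff₀ (by positivity), mul_comm]
        exact sq_mul_tableWeight_le_rectCount hY
      have h2 : 2 * K * (n : ℝ) ^ 2 ≤ V * (rectCount Y / (n : ℝ) ^ 2) := by
        calc 2 * K * (n : ℝ) ^ 2 = (2 * K * L) * ((n : ℝ) ^ 2 / L) := by field_simp
          _ ≤ _ := mul_le_mul (by nlinarith) h1 (by positivity) hV0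
      have := Real.exp_le_exp.2 (neg_le_neg h2)
      linarith [Real.exp_pos (-((2 * L ^ 2 + 6 * K * L) * lightWeight (1 / L) Y
          + (5 * L + 20 * K) * heavyWeight (1 / L) Y))]
  set X := (n : ℝ) ^ 2 * q * Real.exp (-(2 * L ^ 2 + 6 * K * L))
    + 2 * (n * Real.exp (-((5 * L + 20 * K) * (1 / L) * n / 8))) with hXd
  have hab : q * Real.exp (-((5 * L + 20 * K) / 2)) ≤ 1 / L * (5 * L + 20 * K) / 8 := by
    have h1 : q * Real.exp (-((5 * L + 20 * K) / 2)) ≤ Real.exp (-1) := by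
      rw [hqexp, ← Real.exp_add]
      apply Real.exp_le_exp.2
      linarith
    have h2 : Real.exp (-1) ≤ 1 / 2 := by
      have := Real.add_one_le_exp 1
      rw [Real.exp_neg, inv_eq_one_div]
      exact one_div_le_one_div_of_le (by norm_num) (by linarith)
    have h3 : 1 / L * (5 * L + 20 * K) / 8 = 5 / 8 + 20 * K / L / 8 := by
      field_simp
    have h4 : 0 ≤ 20 * K / L / 8 := by positivity
    linarith
  have hbound : ∑ Y ∈ Finset.univ.filter
      (fun Y : Matrix (Fin n) (Fin n) (ZMod q) => ¬ IsAdditiveTable Y ∧ IsMinimalTable Y),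
      Real.exp (-(V * (rectCount Y / (n : ℝ) ^ 2)))
      ≤ Real.exp ((n : ℝ) ^ 2 * l - 2 * K * (n : ℝ) ^ 2) + (Real.exp X - 1) := by
    refine le_trans (Finset.sum_le_sum fun Y hY => hpoint Y (Finset.mem_filter.1 hY).2.2) ?_
    rw [Finset.sum_add_distrib]
    refine add_le_add (by rw [hlq]; exact card_filter_mul_exp_le _ _) ?_
    refine le_trans (sum_filter_not_isAdditiveTable_le (fun Y => Real.exp
      (-((2 * L ^ 2 + 6 * K * L) * lightWeight (1 / L) Y
          + (5 * L + 20 * K) * heavyWeight (1 / L) Y))) (fun Y => by positivity) ?_) ?_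
    · simp [lightWeight, heavyWeight, entryIndicator]
    · exact sub_le_sub_right
        (sum_exp_lightWeight_heavyWeight_le (by linarith) hab) 1
  have h1 : Real.exp ((n : ℝ) ^ 2 * l - 2 * K * (n : ℝ) ^ 2) ≤ Real.exp (-(2 * K)) := by
    apply Real.exp_le_exp.2
    nlinarith
  have he3 : Real.exp (-3) ≤ 1 / 8 := by
    have h2 : (2 : ℝ) ≤ Real.exp 1 := by linarith [Real.add_one_le_exp (1 : ℝ)]
    have h8 : (8 : ℝ) ≤ Real.exp 3 := by
      rw [show (3 : ℝ) = (3 : ℕ) * 1 by norm_num, Real.exp_nat_mul]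
      calc (8 : ℝ) = 2 ^ 3 := by norm_num
        _ ≤ _ := pow_le_pow_left₀ (by norm_num) h2 3
    rw [Real.exp_neg, inv_eq_one_div]
    exact one_div_le_one_div_of_le (by norm_num) h8
  have h2 : (n : ℝ) ^ 2 * q * Real.exp (-(2 * L ^ 2 + 6 * K * L))
      ≤ Real.exp (-(2 * K)) * Real.exp (-3) := by
    rw [hnexp, hqexp, ← Real.exp_nat_mul, ← Real.exp_add, ← Real.exp_add, ← Real.exp_add]
    apply Real.exp_le_exp.2
    push_cast
    nlinarith
  have h3 : n * Real.exp (-((5 * L + 20 * K) * (1 / L) * n / 8))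
      ≤ Real.exp (-(2 * K)) * Real.exp (-3) := by
    have hLn : L ^ 2 ≤ n / 2 := by
      have e1 : Real.log n = Real.log 2 + Real.log (n / 2) := by
        rw [← Real.log_mul (by norm_num) (by positivity)]; congr 1; ring
      have e2 := Real.log_le_sub_one_of_pos (by positivity : (0 : ℝ) < n / 2)
      have e3 := Real.log_two_lt_d9
      rw [hL2, e1]; linarith
    have hnL : 2 * L ≤ n / L := by
      rw [le_div_iff₀ hL0]; nlinarith
    have e4 : (5 * L + 20 * K) * (1 / L) * n / 8 = 5 / 8 * n + 5 / 2 * K * (n / L) := by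
      field_simp; ring
    have e5 : n * Real.exp (-((5 * L + 20 * K) * (1 / L) * n / 8))
        = Real.exp (L ^ 2 + -((5 * L + 20 * K) * (1 / L) * n / 8)) := by
      rw [Real.exp_add, ← hnexp]
    rw [e5, ← Real.exp_add, e4]
    apply Real.exp_le_exp.2
    nlinarith
  have hpos := Real.exp_pos (-(2 * K))
  -- Each of the three terms of `X` is at most `exp (-2 K) / 8`.
  have hX1 : X ≤ 3 / 8 * Real.exp (-(2 * K)) := by
    have := mul_le_mul_of_nonneg_left he3 hpos.le
    rw [hXd]; linarith
  have h4 := exp_sub_one_le_two_mul (x := X) (by positivity) (by linarith)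
  linarith

open Classical in
/-- The sum of the eigenvalue powers over minimal matrices, at a time given through
`V = 2 t (1 - cos (2π / q)) / n ^ 2`. -/
lemma sum_walkEigenvalue_le (hn : 4 ≤ n) (hq : 2 ≤ q) {t : ℕ} {V C : ℝ} (hC : 640 ≤ C)
    (hVt : V * (n : ℝ) ^ 2 = 2 * t * (1 - Real.cos (2 * Real.pi / q)))
    (hV : Real.log n / 2 + 2 * C * Real.log q * √(Real.log n) ≤ V) :
    ∑ Y ∈ Finset.univ.filter (fun Y : Matrix (Fin n) (Fin n) (ZMod q) =>
      ¬ IsAdditiveTable Y ∧ IsMinimalTable Y), (walkEigenvalue Y ^ 2) ^ t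
      ≤ 4 * Real.exp (-(2 * (C * Real.log q))) := by
  have hn' : (4 : ℝ) ≤ n := by exact_mod_cast hn
  have hn0 : (0 : ℝ) < n := by linarith
  have hq' : (2 : ℝ) ≤ q := by exact_mod_cast hq
  have hq0 : (0 : ℝ) < q := by linarith
  set l := Real.log q with hl
  set K := C * l with hKd
  set L := √(Real.log n) with hLd
  have hlog2 := Real.log_two_gt_d9
  have hl0 : 0.69 ≤ l := by
    have := Real.log_le_log (by norm_num) hq'
    linarith
  have hlogn : 1.38 ≤ Real.log n := by
    have h4 : Real.log 4 = 2 * Real.log 2 := by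
      rw [show (4 : ℝ) = 2 ^ 2 by norm_num, Real.log_pow]; norm_num
    have := Real.log_le_log (by norm_num) hn'
    linarith
  have hL2 : L ^ 2 = Real.log n := Real.sq_sqrt (by linarith)
  have hL1 : 1.17 ≤ L := Real.le_sqrt_of_sq_le (by linarith)
  have hK : 440 ≤ K := by rw [hKd]; nlinarith
  have hlK : 640 * l ≤ K := mul_le_mul_of_nonneg_right hC (by linarith)
  have hnexp : (n : ℝ) = Real.exp (L ^ 2) := by rw [hL2, Real.exp_log hn0]
  have hqexp : (q : ℝ) = Real.exp l := by rw [hl, Real.exp_log hq0]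
  rw [← hL2, show 2 * C * l * L = 2 * K * L by rw [hKd]; ring] at hV
  have hn2 : (16 : ℝ) ≤ (n : ℝ) ^ 2 := by nlinarith
  have hKL : 0 ≤ K * L := mul_nonneg (by linarith) (by linarith)
  have hx2 : 1 - Real.cos (2 * Real.pi / q) ≤ 2 := by
    linarith [Real.neg_one_le_cos (2 * Real.pi / q)]
  have ht : (n : ℝ) ^ 2 * (K * L) ≤ 2 * t := by
    have h1 : (n : ℝ) ^ 2 * (2 * K * L) ≤ V * (n : ℝ) ^ 2 := by
      rw [mul_comm V]
      exact mul_le_mul_of_nonneg_left (by nlinarith) (by positivity)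
    have h2 : 2 * t * (1 - Real.cos (2 * Real.pi / q)) ≤ 2 * t * 2 :=
      mul_le_mul_of_nonneg_left hx2 (by positivity)
    linarith
  have hfirst : ∑ Y ∈ Finset.univ.filter (fun Y : Matrix (Fin n) (Fin n) (ZMod q) =>
      ¬ IsAdditiveTable Y ∧ IsMinimalTable Y), Real.exp (-(2 * (t : ℝ)))
      ≤ Real.exp (-(2 * K)) := by
    -- By `ht`, `2 t ≥ n ^ 2 K L`, which outweighs the entropy `n ^ 2 l` and leaves at least `2 K`.
    refine (card_filter_mul_exp_le (n := n) (q := q) _ _).trans (Real.exp_le_exp.2 ?_)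
    have h1 : (n : ℝ) ^ 2 * (K * L - l) ≤ 2 * t - (n : ℝ) ^ 2 * l := by linarith
    have h2 : K ≤ K * L - l := by nlinarith
    nlinarith
  have hsum : ∑ Y ∈ Finset.univ.filter (fun Y : Matrix (Fin n) (Fin n) (ZMod q) =>
      ¬ IsAdditiveTable Y ∧ IsMinimalTable Y), (walkEigenvalue Y ^ 2) ^ t
      ≤ Real.exp (-(2 * K)) + ∑ Y ∈ Finset.univ.filter
        (fun Y : Matrix (Fin n) (Fin n) (ZMod q) => ¬ IsAdditiveTable Y ∧ IsMinimalTable Y),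
        Real.exp (-(V * (rectCount Y / (n : ℝ) ^ 2))) := by
    refine le_trans (Finset.sum_le_sum fun Y _ => walkEigenvalue_sq_pow_le hn hVt Y) ?_
    rw [Finset.sum_add_distrib]
    linarith
  have hrest : ∑ Y ∈ Finset.univ.filter
      (fun Y : Matrix (Fin n) (Fin n) (ZMod q) => ¬ IsAdditiveTable Y ∧ IsMinimalTable Y),
      Real.exp (-(V * (rectCount Y / (n : ℝ) ^ 2))) ≤ 3 * Real.exp (-(2 * K)) := by
    rcases le_total L 50 with hL50 | hL50
    · exact sum_exp_rate_le_of_le_fifty hnexp hqexp hlK hK hL1 hL50 hV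
    · exact sum_exp_rate_le_of_fifty_le hn hnexp hqexp hl0 hlK hK hL50 hV
  linarith

lemma dgDist_le_of_le {row col : Fin n → ZMod q} (hn : 4 ≤ n) (hq : 2 ≤ q) {c : ℝ}
    (hc : 640 / Real.log (Real.log (16 * n)) ≤ c) {t : ℕ}
    (ht : (n : ℝ) ^ 2 / (4 * (1 - Real.cos (2 * Real.pi / q))) * Real.log n
              + (n : ℝ) ^ 2 / (1 - Real.cos (2 * Real.pi / q)) * c
                * Real.log (Real.log (16 * n)) * √(Real.log n) * Real.log q ≤ (t : ℝ)) :
    dgDist row col t ≤ (q : ℝ) ^ (-c) := by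
  have hn' : (4 : ℝ) ≤ n := by exact_mod_cast hn
  have hq' : (2 : ℝ) ≤ q := by exact_mod_cast hq
  have hx := one_sub_cos_pos hq
  set x := 1 - Real.cos (2 * Real.pi / q)
  set Λ := Real.log (Real.log (16 * n)) with hΛ
  have hlog2 := Real.log_two_gt_d9
  -- The factor 16 is used here: `16 n ≥ 64` and `log 64 > e`.
  have hΛ1 : 1 ≤ Λ := by
    have h1 : Real.log 64 = 6 * Real.log 2 := by
      rw [show (64 : ℝ) = 2 ^ 6 by norm_num, Real.log_pow]; norm_num
    have h2 : Real.log 64 ≤ Real.log (16 * n) := Real.log_le_log (by norm_num) (by linarith)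
    have h3 := Real.exp_one_lt_d9
    rw [hΛ, Real.le_log_iff_exp_le (by linarith)]
    linarith
  have hC : 640 ≤ c * Λ := by rwa [div_le_iff₀ (by linarith)] at hc
  have hc0 : 0 ≤ c := by
    by_contra! h
    nlinarith
  have hlq : 0 ≤ Real.log q := Real.log_nonneg (by linarith)
  set V := 2 * t * x / (n : ℝ) ^ 2 with hVd
  have hVt : V * (n : ℝ) ^ 2 = 2 * t * x := by rw [hVd]; field_simp
  have hV : Real.log n / 2 + 2 * (c * Λ) * Real.log q * √(Real.log n) ≤ V := by
    rw [hVd, le_div_iff₀ (by positivity)]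
    have := mul_le_mul_of_nonneg_left ht (by positivity : 0 ≤ 2 * x)
    calc _ = 2 * x * ((n : ℝ) ^ 2 / (4 * x) * Real.log n
              + (n : ℝ) ^ 2 / x * c * Λ * √(Real.log n) * Real.log q) := by
          field_simp; ring
      _ ≤ _ := by linarith
  refine Real.iSup_le (fun A => ?_) (by positivity)
  have h1 := (sq_sum_abs_dgTransition_pow_sub_le (by omega) t A).trans
    (sum_walkEigenvalue_le hn hq hC hVt hV)
  -- The square root of 4 cancels the `1 / 2` in the total variation distance, and `Λ ≥ 1` then
  -- yields `q ^ (-c)`.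
  have h2 : 4 * Real.exp (-(2 * (c * Λ * Real.log q)))
      = (2 * Real.exp (-(c * Λ * Real.log q))) ^ 2 := by
    rw [mul_pow, ← Real.exp_nat_mul]; norm_num
  rw [h2] at h1
  have h3 := le_of_abs_le (abs_le_of_sq_le_sq h1 (by positivity))
  have h4 : Real.exp (-(c * Λ * Real.log q)) ≤ (q : ℝ) ^ (-c) := by
    rw [Real.rpow_def_of_pos (by linarith)]
    apply Real.exp_le_exp.2
    nlinarith [mul_nonneg hc0 hlq]
  linarith

end UpperBound

/-! ### The cell statistic and the second moment method -/

section LowerBound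

variable {n q : ℕ}

/-- The row sums go into the first column and the column sums into the first row; the common total
is subtracted at the corner. -/
lemma nonempty_contingencyTable (hn : 0 < n) {row col : Fin n → ZMod q}
    (h : ∑ i, row i = ∑ j, col j) : Nonempty (ContingencyTable n q row col) := by
  set o : Fin n := ⟨0, hn⟩
  refine ⟨⟨Matrix.of fun i j => (if j = o then row i else 0) + (if i = o then col j else 0)
    - (if i = o then (if j = o then ∑ i, row i else 0) else 0), fun i => ?_, fun j => ?_⟩⟩
  · simp only [Matrix.of_apply, Finset.sum_sub_distrib, Finset.sum_add_distrib]
    by_cases hi : i = o <;> simp [hi, h]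
  · simp only [Matrix.of_apply, Finset.sum_sub_distrib, Finset.sum_add_distrib]
    by_cases hj : j = o <;> simp [hj, h]

/-- The signed indicator of the index `a` in the pair `(i, j)`. -/
def pairSign (a i j : Fin n) : ℤ := (if i = a then 1 else 0) - (if j = a then 1 else 0)

/-- The sign with which the cell `p` occurs in a rectangle. -/
def cellSign (p : Fin n × Fin n) (i j k l : Fin n) : ℤ := pairSign p.1 i j * pairSign p.2 k l

/-- The matrix whose character observes the single cell `p`. -/
def cellTable (q : ℕ) (p : Fin n × Fin n) : Matrix (Fin n) (Fin n) (ZMod q) :=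
  Matrix.single p.1 p.2 1

lemma cellSign_cases (p : Fin n × Fin n) (i j k l : Fin n) :
    cellSign p i j k l = 0 ∨ cellSign p i j k l = 1 ∨ cellSign p i j k l = -1 := by
  unfold cellSign pairSign
  split_ifs <;> simp

lemma rectDiff_cellTable (p : Fin n × Fin n) (i j k l : Fin n) :
    rectDiff (cellTable q p) i j k l = -(cellSign p i j k l : ZMod q) := by
  simp only [rectDiff, cellTable, cellSign, pairSign, Matrix.single_apply, ite_and, @eq_comm _ p.1,
    @eq_comm _ p.2]
  push_cast
  split_ifs <;> ring

lemma rectDiff_cellTable_sub (p p' : Fin n × Fin n) (i j k l : Fin n) :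
    rectDiff (cellTable q p + -cellTable q p') i j k l
      = -((cellSign p i j k l - cellSign p' i j k l : ℤ) : ZMod q) := by
  rw [rectDiff_add, show rectDiff (-cellTable q p') i j k l = -rectDiff (cellTable q p') i j k l by
    simp only [rectDiff, Matrix.neg_apply]; ring, rectDiff_cellTable, rectDiff_cellTable]
  push_cast
  ring

lemma sum_pairSign_sq (a : Fin n) :
    ∑ i, ∑ j, (pairSign a i j : ℝ) ^ 2 = 2 * (n - 1) := by
  have h : ∀ i j : Fin n, (pairSign a i j : ℝ) ^ 2 = (if i = a then 1 else 0)
      + (if j = a then 1 else 0) - 2 * ((if i = a then 1 else 0) * (if j = a then 1 else 0)) := by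
    intro i j
    unfold pairSign
    split_ifs <;> norm_num
  simp only [h, Finset.sum_sub_distrib, Finset.sum_add_distrib, ← Finset.mul_sum]
  simp
  ring

lemma sum_pairSign_sq_mul_le {a b : Fin n} (hab : a ≠ b) :
    ∑ i, ∑ j, (pairSign a i j : ℝ) ^ 2 * (pairSign b i j : ℝ) ^ 2 ≤ 2 := by
  calc _ ≤ ∑ i, ∑ j, ((if i = a then 1 else 0) * (if j = b then (1 : ℝ) else 0)
        + (if i = b then 1 else 0) * (if j = a then 1 else 0)) := by
        refine Finset.sum_le_sum fun i _ => Finset.sum_le_sum fun j _ => ?_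
        unfold pairSign
        split_ifs <;> simp_all
    _ = 2 := by
        simp only [Finset.sum_add_distrib, ← Finset.mul_sum]
        simp
        norm_num

lemma sum_pairSign_sq_mul_self (a : Fin n) :
    ∑ i, ∑ j, (pairSign a i j : ℝ) ^ 2 * (pairSign a i j : ℝ) ^ 2 = 2 * (n - 1) := by
  rw [← sum_pairSign_sq a]
  refine Finset.sum_congr rfl fun i _ => Finset.sum_congr rfl fun j _ => ?_
  unfold pairSign
  split_ifs <;> norm_num

lemma sum_four_mul (F G : Fin n → Fin n → ℝ) :
    ∑ i, ∑ j, ∑ k, ∑ l, F i j * G k l = (∑ i, ∑ j, F i j) * ∑ k, ∑ l, G k l := by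
  simp only [← Finset.mul_sum, ← Finset.sum_mul]

lemma sum_cellSign_sq (p : Fin n × Fin n) :
    ∑ i, ∑ j, ∑ k, ∑ l, (cellSign p i j k l : ℝ) ^ 2 = 4 * ((n : ℝ) - 1) ^ 2 := by
  simp only [cellSign, Int.cast_mul, mul_pow]
  rw [sum_four_mul (fun i j => (pairSign p.1 i j : ℝ) ^ 2), sum_pairSign_sq, sum_pairSign_sq]
  ring

/-- The number of rectangles that have both cells as corners. -/
noncomputable def cellOverlap (p p' : Fin n × Fin n) : ℝ :=
  ∑ i, ∑ j, ∑ k, ∑ l, (cellSign p i j k l : ℝ) ^ 2 * (cellSign p' i j k l : ℝ) ^ 2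

lemma cellOverlap_eq (p p' : Fin n × Fin n) :
    cellOverlap p p'
      = (∑ i, ∑ j, (pairSign p.1 i j : ℝ) ^ 2 * (pairSign p'.1 i j : ℝ) ^ 2)
        * ∑ k, ∑ l, (pairSign p.2 k l : ℝ) ^ 2 * (pairSign p'.2 k l : ℝ) ^ 2 := by
  rw [cellOverlap, ← sum_four_mul]
  refine Finset.sum_congr rfl fun i _ => Finset.sum_congr rfl fun j _ =>
    Finset.sum_congr rfl fun k _ => Finset.sum_congr rfl fun l _ => ?_
  simp only [cellSign, Int.cast_mul]
  ring

lemma cellOverlap_le_of_ne (hn : 2 ≤ n) {p p' : Fin n × Fin n} (h : p ≠ p') :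
    cellOverlap p p' ≤ 4 * ((n : ℝ) - 1) := by
  have hn' : (2 : ℝ) ≤ n := by exact_mod_cast hn
  rw [cellOverlap_eq]
  have h0 : ∀ a b : Fin n, 0 ≤ ∑ i, ∑ j, (pairSign a i j : ℝ) ^ 2 * (pairSign b i j : ℝ) ^ 2 :=
    fun a b => Finset.sum_nonneg fun i _ => Finset.sum_nonneg fun j _ => by positivity
  have hle : ∀ a b : Fin n, ∑ i, ∑ j, (pairSign a i j : ℝ) ^ 2 * (pairSign b i j : ℝ) ^ 2
      ≤ 2 * (n - 1) := by
    intro a b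
    by_cases hab : a = b
    · rw [hab, sum_pairSign_sq_mul_self]
    · linarith [sum_pairSign_sq_mul_le hab]
  by_cases h1 : p.1 = p'.1
  · have h2 : p.2 ≠ p'.2 := fun h2 => h (Prod.ext h1 h2)
    have := mul_le_mul (hle p.1 p'.1) (sum_pairSign_sq_mul_le h2) (h0 _ _) (by linarith)
    linarith
  · have := mul_le_mul (sum_pairSign_sq_mul_le h1) (hle p.2 p'.2) (h0 _ _) (by norm_num)
    linarith

lemma cellOverlap_le_four {p p' : Fin n × Fin n} (h1 : p.1 ≠ p'.1) (h2 : p.2 ≠ p'.2) :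
    cellOverlap p p' ≤ 4 := by
  rw [cellOverlap_eq]
  have := mul_le_mul (sum_pairSign_sq_mul_le h1) (sum_pairSign_sq_mul_le h2)
    (Finset.sum_nonneg fun i _ => Finset.sum_nonneg fun j _ => by positivity) (by norm_num)
  linarith

/-- With a row and a column that avoid both cells, `p` spans a rectangle that does not have `p'` as
a corner. -/
lemma not_isAdditiveTable_cellTable_sub (hn : 3 ≤ n) (hq : 2 ≤ q) {p p' : Fin n × Fin n}
    (h : p ≠ p') : ¬ IsAdditiveTable (cellTable q p + -cellTable q p') := by
  have : Fact (1 < q) := ⟨by omega⟩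
  have hex : ∀ a b : Fin n, ∃ c, c ≠ a ∧ c ≠ b := by
    intro a b
    have hcard : ({a, b} : Finset (Fin n)).card < Fintype.card (Fin n) := by
      have := Finset.card_le_two (a := a) (b := b)
      simp only [Fintype.card_fin]; omega
    obtain ⟨c, hc⟩ := Finset.exists_mem_notMem_of_card_lt_card
      (s := {a, b}) (t := Finset.univ) (by simpa using hcard)
    exact ⟨c, by simpa using hc.2⟩
  obtain ⟨a, b⟩ := p
  obtain ⟨a', b'⟩ := p'
  obtain ⟨j, hj, hj'⟩ := hex a a'
  obtain ⟨l, hl, hl'⟩ := hex b b'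
  intro hadd
  have key : cellSign (a, b) a j b l - cellSign (a', b') a j b l = 1 := by
    by_cases ha : a = a'
    · have hb : b ≠ b' := fun hb => h (by rw [ha, hb])
      simp [cellSign, pairSign, hj, hl, hj', hl', hb]
    · simp [cellSign, pairSign, hj, hl, hj', hl', ha]
  have := hadd a j b l
  rw [rectDiff_cellTable_sub, key] at this
  simp at this

variable [NeZero q]

lemma one_sub_stdAddChar_re_cellSign (p : Fin n × Fin n) (i j k l : Fin n) :
    1 - (ZMod.stdAddChar (rectDiff (cellTable q p) i j k l)).re
      = (1 - Real.cos (2 * Real.pi / q)) * (cellSign p i j k l : ℝ) ^ 2 := by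
  rw [rectDiff_cellTable]
  rcases cellSign_cases p i j k l with h | h | h <;> rw [h]
  · simp
  · rw [stdAddChar_re_neg]; simp [stdAddChar_one_re]
  · simp [stdAddChar_one_re]

/-- A rectangle meeting just one of the cells contributes exactly `1 - cos (2π / q)`. If it meets
both, the left side is zero and nonnegativity suffices. -/
lemma le_one_sub_stdAddChar_re_cellSign_sub (p p' : Fin n × Fin n) (i j k l : Fin n) :
    (1 - Real.cos (2 * Real.pi / q)) * ((cellSign p i j k l : ℝ) ^ 2
        + (cellSign p' i j k l : ℝ) ^ 2
        - 2 * ((cellSign p i j k l : ℝ) ^ 2 * (cellSign p' i j k l : ℝ) ^ 2))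
      ≤ 1 - (ZMod.stdAddChar (rectDiff (cellTable q p + -cellTable q p') i j k l)).re := by
  rw [rectDiff_cellTable_sub, stdAddChar_re_neg]
  have hle : ∀ z : ZMod q, 0 ≤ 1 - (ZMod.stdAddChar z).re := fun z => by
    linarith [(abs_le.1 (abs_stdAddChar_re_le_one z)).2]
  rcases cellSign_cases p i j k l with h | h | h <;>
    rcases cellSign_cases p' i j k l with h' | h' | h' <;> rw [h, h'] <;>
    first
    | (norm_num [stdAddChar_re_neg, stdAddChar_one_re]; done)
    | (refine le_trans (le_of_eq ?_) (hle _); norm_num)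

lemma one_sub_stdAddChar_re_cellSign_sub_le (p p' : Fin n × Fin n) (i j k l : Fin n) :
    1 - (ZMod.stdAddChar (rectDiff (cellTable q p + -cellTable q p') i j k l)).re
      ≤ 2 * ((cellSign p i j k l : ℝ) ^ 2 + (cellSign p' i j k l : ℝ) ^ 2) := by
  rw [rectDiff_cellTable_sub, stdAddChar_re_neg]
  have hle : ∀ z : ZMod q, 1 - (ZMod.stdAddChar z).re ≤ 2 := fun z => by
    linarith [(abs_le.1 (abs_stdAddChar_re_le_one z)).1]
  rcases cellSign_cases p i j k l with h | h | h <;>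
    rcases cellSign_cases p' i j k l with h' | h' | h' <;> rw [h, h'] <;>
    first
    | (norm_num; done)
    | (refine (hle _).trans ?_; norm_num)

lemma walkEigenvalue_cellTable (hn : 2 ≤ n) (p : Fin n × Fin n) :
    walkEigenvalue (cellTable q p) = 1 - 4 * (1 - Real.cos (2 * Real.pi / q)) / (n : ℝ) ^ 2 := by
  have hn' : (2 : ℝ) ≤ n := by exact_mod_cast hn
  have h := one_sub_walkEigenvalue_mul hn (cellTable q p)
  simp only [one_sub_stdAddChar_re_cellSign, ← Finset.mul_sum] at h
  rw [sum_cellSign_sq] at h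
  have hn1 : ((n : ℝ) - 1) ≠ 0 := by linarith
  have hn0 : (n : ℝ) ≠ 0 := by linarith
  have h2 : 1 - walkEigenvalue (cellTable q p)
      = 4 * (1 - Real.cos (2 * Real.pi / q)) / (n : ℝ) ^ 2 := by
    rw [eq_div_iff (by positivity)]
    apply mul_right_cancel₀ (pow_ne_zero 2 hn1)
    linear_combination h
  linarith

lemma walkEigenvalue_cellTable_sub_le (hn : 2 ≤ n) (p p' : Fin n × Fin n) :
    walkEigenvalue (cellTable q p + -cellTable q p')
      ≤ 1 - 8 * (1 - Real.cos (2 * Real.pi / q)) / (n : ℝ) ^ 2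
        + 2 * (1 - Real.cos (2 * Real.pi / q)) * cellOverlap p p' / ((n : ℝ) * (n - 1)) ^ 2 := by
  have hn' : (2 : ℝ) ≤ n := by exact_mod_cast hn
  have hn1 : 0 < (n : ℝ) - 1 := by linarith
  have hn0 : 0 < (n : ℝ) := by linarith
  have h := one_sub_walkEigenvalue_mul hn (cellTable q p + -cellTable q p')
  set x := 1 - Real.cos (2 * Real.pi / q) with hx
  have h2 : x * (8 * ((n : ℝ) - 1) ^ 2 - 2 * cellOverlap p p')
      ≤ (1 - walkEigenvalue (cellTable q p + -cellTable q p')) * ((n : ℝ) * (n - 1)) ^ 2 := by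
    rw [h]
    calc _ = ∑ i, ∑ j, ∑ k, ∑ l, x * ((cellSign p i j k l : ℝ) ^ 2
          + (cellSign p' i j k l : ℝ) ^ 2
          - 2 * ((cellSign p i j k l : ℝ) ^ 2 * (cellSign p' i j k l : ℝ) ^ 2)) := by
          simp only [← Finset.mul_sum, Finset.sum_sub_distrib, Finset.sum_add_distrib]
          rw [sum_cellSign_sq, sum_cellSign_sq, cellOverlap]
          ring
      _ ≤ _ := Finset.sum_le_sum fun i _ => Finset.sum_le_sum fun j _ =>
          Finset.sum_le_sum fun k _ => Finset.sum_le_sum fun l _ =>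
            le_one_sub_stdAddChar_re_cellSign_sub p p' i j k l
  have h3 : x * (8 * ((n : ℝ) - 1) ^ 2 - 2 * cellOverlap p p') / ((n : ℝ) * (n - 1)) ^ 2
      ≤ 1 - walkEigenvalue (cellTable q p + -cellTable q p') := by
    rw [div_le_iff₀ (by positivity)]
    exact h2
  have h4 : x * (8 * ((n : ℝ) - 1) ^ 2 - 2 * cellOverlap p p') / ((n : ℝ) * (n - 1)) ^ 2
      = 8 * x / (n : ℝ) ^ 2 - 2 * x * cellOverlap p p' / ((n : ℝ) * (n - 1)) ^ 2 := by
    field_simp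
  linarith

/-- Only rectangles meeting one of the cells count, each with at most 2, so `1 - λ ≤ 16 / n ^ 2 ≤
1`. The sign is needed to raise upper bounds for `λ` to the power `t`. -/
lemma walkEigenvalue_cellTable_sub_nonneg (hn : 4 ≤ n) (p p' : Fin n × Fin n) :
    0 ≤ walkEigenvalue (cellTable q p + -cellTable q p') := by
  have hn' : (4 : ℝ) ≤ n := by exact_mod_cast hn
  have hn1 : 0 < (n : ℝ) - 1 := by linarith
  have hn0 : 0 < (n : ℝ) := by linarith
  have h := one_sub_walkEigenvalue_mul (by omega) (cellTable q p + -cellTable q p')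
  have h2 : (1 - walkEigenvalue (cellTable q p + -cellTable q p')) * ((n : ℝ) * (n - 1)) ^ 2
      ≤ 16 * ((n : ℝ) - 1) ^ 2 := by
    rw [h]
    calc _ ≤ ∑ i, ∑ j, ∑ k, ∑ l, 2 * ((cellSign p i j k l : ℝ) ^ 2
          + (cellSign p' i j k l : ℝ) ^ 2) :=
          Finset.sum_le_sum fun i _ => Finset.sum_le_sum fun j _ =>
          Finset.sum_le_sum fun k _ => Finset.sum_le_sum fun l _ =>
            one_sub_stdAddChar_re_cellSign_sub_le p p' i j k l
      _ = _ := by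
          simp only [← Finset.mul_sum, Finset.sum_add_distrib]
          rw [sum_cellSign_sq, sum_cellSign_sq]
          ring
  by_contra! h3
  have h4 : 0 < ((n : ℝ) * (n - 1)) ^ 2 := by positivity
  have h5 : 0 ≤ ((n : ℝ) ^ 2 - 16) * (n - 1) ^ 2 := mul_nonneg (by nlinarith) (by positivity)
  nlinarith

variable {row col : Fin n → ZMod q}

lemma sum_dgTransition_pow_mul_re (t : ℕ) (A : ContingencyTable n q row col)
    (Y : Matrix (Fin n) (Fin n) (ZMod q)) :
    ∑ B : ContingencyTable n q row col,
      (dgTransition row col ^ t) A B * (tableChar Y (B.1 + -A.1)).re = walkEigenvalue Y ^ t := by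
  have h := sum_dgTransition_pow_mul_tableChar Y t A
  have h2 : ∑ B : ContingencyTable n q row col,
      (((dgTransition row col ^ t) A B : ℝ) : ℂ) * tableChar Y (B.1 + -A.1)
      = ((walkEigenvalue Y ^ t : ℝ) : ℂ) := by
    simp only [tableChar_add_right, ← mul_assoc, ← Finset.sum_mul]
    rw [h, mul_assoc, ← tableChar_add_right, add_neg_cancel,
      (tableChar_eq_one_iff Y 0).2 (by simp [tablePairing])]
    push_cast
    ring
  have h3 := congrArg Complex.re h2
  rw [Complex.ofReal_re, Complex.re_sum] at h3
  simpa only [Complex.re_ofReal_mul] using h3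

lemma sum_dgTransition_pow (hn : 2 ≤ n) (t : ℕ) (A : ContingencyTable n q row col) :
    ∑ B : ContingencyTable n q row col, (dgTransition row col ^ t) A B = 1 := by
  have h := sum_dgTransition_pow_mul_re t A 0
  rw [walkEigenvalue_eq_one_of_rectDiff hn (fun i j k l => by simp [rectDiff]), one_pow] at h
  rw [← h]
  refine Finset.sum_congr rfl fun B _ => ?_
  rw [(tableChar_eq_one_iff _ _).2 (by simp [tablePairing])]
  simp

lemma sum_tableChar_sub_re_eq_zero (A : ContingencyTable n q row col)
    {Y : Matrix (Fin n) (Fin n) (ZMod q)} (hY : ¬ IsAdditiveTable Y) :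
    ∑ B : ContingencyTable n q row col, (tableChar Y (B.1 + -A.1)).re = 0 := by
  rw [← Complex.re_sum]
  simp only [tableChar_add_right, ← Finset.sum_mul]
  rw [sum_tableChar_contingencyTable_eq_zero hY]
  simp

/-- The distinguishing statistic for the walk started at `A`. -/
noncomputable def cellStatistic (A B : Matrix (Fin n) (Fin n) (ZMod q)) : ℂ :=
  ∑ p : Fin n × Fin n, tableChar (cellTable q p) (B + -A)

lemma norm_cellStatistic_sq (A B : Matrix (Fin n) (Fin n) (ZMod q)) :
    ‖cellStatistic A B‖ ^ 2 = ∑ p : Fin n × Fin n, ∑ p' : Fin n × Fin n,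
      (tableChar (cellTable q p + -cellTable q p') (B + -A)).re := by
  have h : ((‖cellStatistic A B‖ ^ 2 : ℝ) : ℂ) = ∑ p : Fin n × Fin n, ∑ p' : Fin n × Fin n,
      tableChar (cellTable q p + -cellTable q p') (B + -A) := by
    push_cast
    rw [← Complex.mul_conj', cellStatistic, map_sum, Finset.sum_mul_sum]
    simp only [tableChar_add_left, tableChar_neg_left]
  have h2 := congrArg Complex.re h
  rw [Complex.ofReal_re] at h2
  rw [h2]; simp

/-- The second moment method: a lower bound for the distance to uniformity in terms of the
eigenvalues of cells and pairs of cells. -/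
lemma le_dgDist_of_eigenvalues (hn : 4 ≤ n) (hq : 2 ≤ q) (hrc : ∑ i, row i = ∑ j, col j) (t : ℕ)
    {μ : ℝ} (hμ : 0 < μ) (hμ1 : ∀ p : Fin n × Fin n, walkEigenvalue (cellTable q p) = μ) :
    1 - 2 / ((n : ℝ) ^ 2 * μ ^ t) ^ 2 * (∑ p : Fin n × Fin n, ∑ p' : Fin n × Fin n,
        walkEigenvalue (cellTable q p + -cellTable q p') ^ t
        - ((n : ℝ) ^ 2 * μ ^ t) ^ 2 + (n : ℝ) ^ 2) ≤ dgDist row col t := by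
  obtain ⟨A⟩ := nonempty_contingencyTable (by omega) hrc
  have hn0 : 0 < (n : ℝ) := by exact_mod_cast (by omega : 0 < n)
  set m := (n : ℝ) ^ 2 * μ ^ t with hm
  have hm0 : 0 < m := by positivity
  set P : ContingencyTable n q row col → ℝ := fun B => (dgTransition row col ^ t) A B with hP
  set N : ℝ := (Fintype.card (ContingencyTable n q row col) : ℝ) with hN
  have hN0 : 0 < N := by rw [hN]; exact_mod_cast Fintype.card_pos_iff.2 ⟨A⟩
  set f : ContingencyTable n q row col → ℂ := fun B => cellStatistic A.1 B.1 with hf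
  have hP0 : ∀ B, 0 ≤ P B := fun B => dgTransition_pow_nonneg t A B
  have hP1 : ∑ B, P B = 1 := sum_dgTransition_pow (by omega) t A
  have hπ1 : ∑ _B : ContingencyTable n q row col, 1 / N = 1 := by
    rw [Finset.sum_const, nsmul_eq_mul, Finset.card_univ]
    field_simp
    exact hN.symm
  have hEf : ∑ B, P B * (f B).re = m := by
    simp only [hf, cellStatistic, Complex.re_sum, Finset.mul_sum]
    rw [Finset.sum_comm]
    simp only [hP, sum_dgTransition_pow_mul_re, hμ1]
    simp [hm, sq]
  have hEf2 : ∑ B, P B * ‖f B‖ ^ 2 = ∑ p : Fin n × Fin n, ∑ p' : Fin n × Fin n,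
        walkEigenvalue (cellTable q p + -cellTable q p') ^ t := by
    simp only [hf, norm_cellStatistic_sq, Finset.mul_sum]
    rw [Finset.sum_comm]
    refine Finset.sum_congr rfl fun p _ => ?_
    rw [Finset.sum_comm]
    exact Finset.sum_congr rfl fun p' _ => sum_dgTransition_pow_mul_re t A _
  have hπf2 : ∑ B, 1 / N * ‖f B‖ ^ 2 = (n : ℝ) ^ 2 := by
    rw [← Finset.mul_sum]
    have : ∑ B, ‖f B‖ ^ 2 = ∑ p : Fin n × Fin n, N := by
      simp only [hf, norm_cellStatistic_sq]
      rw [Finset.sum_comm]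
      refine Finset.sum_congr rfl fun p _ => ?_
      rw [Finset.sum_comm, Finset.sum_eq_single p]
      · rw [add_neg_cancel, Finset.sum_congr rfl fun B _ => by
          rw [(tableChar_eq_one_iff 0 _).2 (by simp [tablePairing])]]
        simp [hN]
      · intro p' _ hp'
        exact sum_tableChar_sub_re_eq_zero A
          (not_isAdditiveTable_cellTable_sub (by omega) hq hp'.symm)
      · simp
    rw [this]
    simp only [Finset.sum_const, Finset.card_univ, Fintype.card_prod, Fintype.card_fin,
      nsmul_eq_mul]
    push_cast
    field_simp
  have hsub : ∀ B, ‖f B - (m : ℂ)‖ ^ 2 = ‖f B‖ ^ 2 - 2 * m * (f B).re + m ^ 2 := by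
    intro B
    rw [← Complex.normSq_eq_norm_sq, ← Complex.normSq_eq_norm_sq, Complex.normSq_apply,
      Complex.normSq_apply]
    simp
    ring
  have hEv : ∑ B, P B * ‖f B - (m : ℂ)‖ ^ 2 = ∑ B, P B * ‖f B‖ ^ 2 - m ^ 2 := by
    have : ∀ B, P B * ‖f B - (m : ℂ)‖ ^ 2
        = P B * ‖f B‖ ^ 2 - 2 * m * (P B * (f B).re) + m ^ 2 * P B := by
      intro B; rw [hsub]; ring
    rw [Finset.sum_congr rfl fun B _ => this B, Finset.sum_add_distrib, Finset.sum_sub_distrib,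
      ← Finset.mul_sum, ← Finset.mul_sum, hEf, hP1]
    ring
  -- At each `B` the statistic is far from `m` or far from 0: `m ^ 2 ≤ 2 ‖f - m‖ ^ 2 + 2 ‖f‖ ^ 2`.
  -- The overlap of the two laws is thus bounded by the spread under each of them.
  have hpoint : ∀ B, min (P B) (1 / N)
      ≤ 2 / m ^ 2 * (P B * ‖f B - (m : ℂ)‖ ^ 2 + 1 / N * ‖f B‖ ^ 2) := by
    intro B
    have h1 : m ^ 2 ≤ 2 * ‖f B - (m : ℂ)‖ ^ 2 + 2 * ‖f B‖ ^ 2 := by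
      have h2 : m ≤ ‖f B - (m : ℂ)‖ + ‖f B‖ := by
        have := norm_sub_norm_le (m : ℂ) (f B)
        rw [Complex.norm_real, Real.norm_eq_abs, abs_of_pos hm0, norm_sub_rev] at this
        linarith
      have := pow_le_pow_left₀ hm0.le h2 2
      nlinarith [sq_nonneg (‖f B - (m : ℂ)‖ - ‖f B‖)]
    have hmin0 : 0 ≤ min (P B) (1 / N) := le_min (hP0 B) (by positivity)
    have h3 : min (P B) (1 / N) * ‖f B - (m : ℂ)‖ ^ 2 ≤ P B * ‖f B - (m : ℂ)‖ ^ 2 :=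
      mul_le_mul_of_nonneg_right (min_le_left _ _) (by positivity)
    have h4 : min (P B) (1 / N) * ‖f B‖ ^ 2 ≤ 1 / N * ‖f B‖ ^ 2 :=
      mul_le_mul_of_nonneg_right (min_le_right _ _) (by positivity)
    have h5 := mul_le_mul_of_nonneg_left h1 hmin0
    rw [div_mul_eq_mul_div, le_div_iff₀ (by positivity)]
    linarith
  have habs : ∀ B, |P B - 1 / N| = P B + 1 / N - 2 * min (P B) (1 / N) := by
    intro B
    rcases le_total (P B) (1 / N) with h | h
    · rw [min_eq_left h, abs_of_nonpos (by linarith)]; ring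
    · rw [min_eq_right h, abs_of_nonneg (by linarith)]; ring
  have hmain : 1 - 2 / m ^ 2 * (∑ p : Fin n × Fin n, ∑ p' : Fin n × Fin n,
        walkEigenvalue (cellTable q p + -cellTable q p') ^ t - m ^ 2 + (n : ℝ) ^ 2)
      ≤ (1 / 2 : ℝ) * ∑ B, |P B - 1 / N| := by
    have h1 := Finset.sum_le_sum fun B (_ : B ∈ Finset.univ) => hpoint B
    rw [← Finset.mul_sum, Finset.sum_add_distrib, hEv, hEf2, hπf2] at h1
    rw [Finset.sum_congr rfl fun B _ => habs B, Finset.sum_sub_distrib, Finset.sum_add_distrib,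
      hP1, hπ1, ← Finset.mul_sum]
    linarith
  refine hmain.trans ?_
  exact le_ciSup (f := fun A : ContingencyTable n q row col => (1 / 2 : ℝ)
    * ∑ B : ContingencyTable n q row col, |(dgTransition row col ^ t) A B
      - 1 / (Fintype.card (ContingencyTable n q row col) : ℝ)|) (Set.finite_range _).bddAbove A

end LowerBound

/-! ### Variance estimate and the lower bound on the distance -/

section LowerBoundFinal

lemma exp_le_one_add_two_mul {x : ℝ} (h0 : 0 ≤ x) (h1 : x ≤ 1 / 2) : Real.exp x ≤ 1 + 2 * x := by
  linarith [exp_sub_one_le_two_mul h0 h1]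

variable {n q : ℕ} [NeZero q]

/-- As `s ≥ 1 / 2`, one has `s + δ ≤ s (1 + 2 δ)`. -/
lemma pow_le_pow_mul_exp {lam s δ : ℝ} (h0 : 0 ≤ lam) (hs : 1 / 2 ≤ s) (hδ : 0 ≤ δ)
    (h : lam ≤ s + δ) (t : ℕ) : lam ^ t ≤ s ^ t * Real.exp (2 * δ * t) := by
  have h1 : lam ≤ s * Real.exp (2 * δ) := by
    have := Real.add_one_le_exp (2 * δ)
    nlinarith
  calc lam ^ t ≤ (s * Real.exp (2 * δ)) ^ t := pow_le_pow_left₀ h0 h1 t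
    _ = _ := by rw [mul_pow, ← Real.exp_nat_mul]; congr 2; ring

lemma log_bounds_of_large {r : ℝ} (hr : 4096 ≤ r) :
    4 * Real.log r ≤ r - 2 ∧ 16 * Real.log r ≤ r := by
  have h1 : 64 ≤ √r := Real.le_sqrt_of_sq_le (by linarith)
  have h2 : √r ^ 2 = r := Real.sq_sqrt (by linarith)
  have h3 := Real.log_le_sub_one_of_pos (by linarith : 0 < √r)
  rw [Real.log_sqrt (by linarith)] at h3
  constructor <;> nlinarith

lemma sum_walkEigenvalue_cellTable_sub_le (hn : 4096 ≤ n) (hq : 2 ≤ q) {t : ℕ}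
    (ht : (t : ℝ) * (4 * (1 - Real.cos (2 * Real.pi / q))) ≤ (n : ℝ) ^ 2 * Real.log n) {μ : ℝ}
    (hμ : μ = 1 - 4 * (1 - Real.cos (2 * Real.pi / q)) / (n : ℝ) ^ 2) :
    ∑ p : Fin n × Fin n, ∑ p' : Fin n × Fin n,
        walkEigenvalue (cellTable q p + -cellTable q p') ^ t
      ≤ ((n : ℝ) ^ 2 * μ ^ t) ^ 2 + (n : ℝ) ^ 2 + 8 * ((n : ℝ) ^ 2 * μ ^ t) ^ 2 / n := by
  have hn' : (4096 : ℝ) ≤ n := by exact_mod_cast hn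
  have hn0 : (0 : ℝ) < n := by linarith
  have hn1 : (0 : ℝ) < (n : ℝ) - 1 := by linarith
  have hx := one_sub_cos_pos hq
  have hx2 : 1 - Real.cos (2 * Real.pi / q) ≤ 2 := by
    linarith [Real.neg_one_le_cos (2 * Real.pi / q)]
  set x := 1 - Real.cos (2 * Real.pi / q) with hxd
  obtain ⟨hlog1, hlog2⟩ := log_bounds_of_large hn'
  have hlog0 : 0 ≤ Real.log n := Real.log_nonneg (by linarith)
  have hy : 8 * x / (n : ℝ) ^ 2 ≤ 1 / 2 := by
    rw [div_le_iff₀ (by positivity)]; nlinarith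
  have hy0 : 0 ≤ 4 * x / (n : ℝ) ^ 2 := by positivity
  have hμsq : 1 - 8 * x / (n : ℝ) ^ 2 ≤ μ ^ 2 := by
    rw [hμ]
    have : 8 * x / (n : ℝ) ^ 2 = 2 * (4 * x / (n : ℝ) ^ 2) := by ring
    nlinarith
  have hμt : 0 ≤ (μ ^ 2) ^ t := by positivity
  have hpair : ∀ p p' : Fin n × Fin n, ∀ o s : ℝ, cellOverlap p p' ≤ o → 0 ≤ o →
      o * Real.log n / ((n : ℝ) - 1) ^ 2 ≤ s →
      walkEigenvalue (cellTable q p + -cellTable q p') ^ t ≤ (μ ^ 2) ^ t * Real.exp s := by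
    intro p p' o s ho ho0 hs
    have h1 := walkEigenvalue_cellTable_sub_le (q := q) (by omega) p p'
    rw [← hxd] at h1
    have h2 : 2 * x * cellOverlap p p' / ((n : ℝ) * (n - 1)) ^ 2
        ≤ 2 * x * o / ((n : ℝ) * (n - 1)) ^ 2 := by gcongr
    refine (pow_le_pow_mul_exp (walkEigenvalue_cellTable_sub_nonneg (by omega) p p')
      (s := μ ^ 2) (δ := 2 * x * o / ((n : ℝ) * (n - 1)) ^ 2) (by linarith) (by positivity)
      (by linarith) t).trans ?_
    refine mul_le_mul_of_nonneg_left (Real.exp_le_exp.2 (le_trans ?_ hs)) hμt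
    have h3 : 2 * (2 * x * o / ((n : ℝ) * (n - 1)) ^ 2) * t
        = o * (t * (4 * x)) / (((n : ℝ) - 1) ^ 2 * (n : ℝ) ^ 2) := by
      field_simp
      ring
    rw [h3, div_le_div_iff₀ (by positivity) (by positivity)]
    have := mul_le_mul_of_nonneg_left ht (by positivity : 0 ≤ o * ((n : ℝ) - 1) ^ 2)
    linarith
  have he1 : Real.exp 1 ≤ 3 := by linarith [Real.exp_one_lt_d9]
  have he2 : Real.exp (1 / n) ≤ 1 + 2 / n := by
    have := exp_le_one_add_two_mul (x := 1 / (n : ℝ)) (by positivity)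
      (by rw [div_le_div_iff₀ hn0 (by norm_num)]; linarith)
    rwa [mul_one_div] at this
  -- Equal cells are bounded by 1. Distinct cells on a common line lose at most a factor `e ≤ 3`;
  -- there are only of order `n ^ 3` such pairs. The generic pairs lose only `1 + 2 / n`.
  have hbound : ∀ p p' : Fin n × Fin n, walkEigenvalue (cellTable q p + -cellTable q p') ^ t
      ≤ (if p = p' then 1 else 0) + (μ ^ 2) ^ t * ((if p.1 = p'.1 then 3 else 0)
        + (if p.2 = p'.2 then 3 else 0) + (1 + 2 / n)) := by
    intro p p'
    have hn2 : 0 ≤ 2 / (n : ℝ) := by positivity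
    by_cases h : p = p'
    · rw [if_pos h]
      have h1 : walkEigenvalue (cellTable q p + -cellTable q p') ^ t ≤ 1 :=
        pow_le_one₀ (walkEigenvalue_cellTable_sub_nonneg (by omega) p p')
          (walkEigenvalue_le_one (by omega) _)
      have : 0 ≤ (μ ^ 2) ^ t * ((if p.1 = p'.1 then 3 else 0)
        + (if p.2 = p'.2 then 3 else 0) + (1 + 2 / n)) :=
        mul_nonneg hμt (by split_ifs <;> linarith)
      linarith
    rw [if_neg h, zero_add]
    by_cases h12 : p.1 ≠ p'.1 ∧ p.2 ≠ p'.2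
    · refine (hpair p p' 4 (1 / n) (cellOverlap_le_four h12.1 h12.2) (by norm_num) ?_).trans ?_
      · rw [div_le_div_iff₀ (by positivity) hn0]
        nlinarith
      · rw [if_neg h12.1, if_neg h12.2]
        exact mul_le_mul_of_nonneg_left (by linarith) hμt
    · refine (hpair p p' (4 * ((n : ℝ) - 1)) 1 (cellOverlap_le_of_ne (by omega) h)
        (by linarith) ?_).trans ?_
      · rw [div_le_one (by positivity)]
        nlinarith
      · refine mul_le_mul_of_nonneg_left ?_ hμt
        rw [not_and_or, not_not, not_not] at h12
        rcases h12 with h12 | h12 <;> rw [if_pos h12] <;> split_ifs <;> linarith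
  calc _ ≤ ∑ p : Fin n × Fin n, ∑ p' : Fin n × Fin n, ((if p = p' then 1 else 0)
        + (μ ^ 2) ^ t * ((if p.1 = p'.1 then 3 else 0)
        + (if p.2 = p'.2 then 3 else 0) + (1 + 2 / n))) :=
        Finset.sum_le_sum fun p _ => Finset.sum_le_sum fun p' _ => hbound p p'
    _ = (n : ℝ) ^ 2 + (μ ^ 2) ^ t * (3 * (n : ℝ) ^ 3 + 3 * (n : ℝ) ^ 3
        + (n : ℝ) ^ 4 * (1 + 2 / n)) := by
        have h1 : ∑ p : Fin n × Fin n, ∑ p' : Fin n × Fin n, (if p = p' then (1 : ℝ) else 0)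
            = (n : ℝ) ^ 2 := by simp [sq]
        have h2 : ∀ p : Fin n × Fin n, ∑ p' : Fin n × Fin n, (if p.1 = p'.1 then (3 : ℝ) else 0)
            = 3 * n := by
          intro p
          rw [Fintype.sum_prod_type]
          change ∑ a, ∑ _b : Fin n, (if p.1 = a then (3 : ℝ) else 0) = _
          simp [mul_comm]
        have h3 : ∀ p : Fin n × Fin n, ∑ p' : Fin n × Fin n, (if p.2 = p'.2 then (3 : ℝ) else 0)
            = 3 * n := by
          intro p
          rw [Fintype.sum_prod_type]
          change ∑ _a : Fin n, ∑ b, (if p.2 = b then (3 : ℝ) else 0) = _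
          simp [mul_comm]
        simp only [Finset.sum_add_distrib, ← Finset.mul_sum, h1, h2, h3]
        simp only [Finset.sum_const, Finset.card_univ, Fintype.card_prod, Fintype.card_fin,
          nsmul_eq_mul]
        push_cast
        ring
    _ = _ := by
        rw [← pow_mul, mul_comm 2 t, pow_mul]
        field_simp
        ring

/-- One has `1 - y ≥ exp (-y - 2 y ^ 2)` for `y ≤ 1 / 2`. Since `y ≤ 1 / r`, the quadratic term
costs at most a factor 2 over `t` steps. -/
lemma exp_div_le_one_sub_pow {r x K : ℝ} {t : ℕ} (hr : 4096 ≤ r) (hx : 0 < x) (hx2 : x ≤ 2)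
    (hK : 0 ≤ K) (ht : (t : ℝ) * (4 * x) ≤ r ^ 2 * (Real.log r - K)) :
    0 < 1 - 4 * x / r ^ 2 ∧ Real.exp K / (2 * r) ≤ (1 - 4 * x / r ^ 2) ^ t := by
  have hr0 : 0 < r := by linarith
  have hlog2 := Real.log_two_gt_d9
  have hlog16 := (log_bounds_of_large hr).2
  have hy0 : 0 < 4 * x / r ^ 2 := by positivity
  have hyn : 4 * x / r ^ 2 * r ≤ 1 := by
    rw [div_mul_eq_mul_div, div_le_one (by positivity)]; nlinarith
  have hty : t * (4 * x / r ^ 2) ≤ Real.log r - K := by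
    rw [mul_div_assoc', div_le_iff₀ (by positivity)]; linarith
  generalize 4 * x / r ^ 2 = y at hy0 hyn hty ⊢
  have hy2 : y ≤ 1 / 2 := by nlinarith
  have hμ0 : 0 < 1 - y := by linarith
  refine ⟨hμ0, ?_⟩
  have hμexp : Real.exp (-(y + 2 * y ^ 2)) ≤ 1 - y := by
    have h1 := Real.add_one_le_exp (y + 2 * y ^ 2)
    rw [Real.exp_neg, inv_le_comm₀ (Real.exp_pos _) hμ0]
    refine le_trans ?_ h1
    rw [inv_le_iff_one_le_mul₀ hμ0]
    nlinarith [mul_nonneg (sq_nonneg y) (by linarith : 0 ≤ 1 - 2 * y)]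
  have h1 : Real.exp (-(Real.log r - K + Real.log 2)) ≤ (1 - y) ^ t := by
    calc _ ≤ Real.exp (-(y + 2 * y ^ 2)) ^ t := by
          rw [← Real.exp_nat_mul]
          apply Real.exp_le_exp.2
          have h2 : t * (2 * y ^ 2) ≤ Real.log 2 := by
            have h3 : t * y * y ≤ Real.log r * y :=
              mul_le_mul_of_nonneg_right (by linarith) hy0.le
            nlinarith
          linarith
      _ ≤ _ := pow_le_pow_left₀ (Real.exp_pos _).le hμexp t
  refine le_trans (le_of_eq ?_) h1
  rw [show -(Real.log r - K + Real.log 2) = K - (Real.log 2 + Real.log r) by ring,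
    Real.exp_sub, Real.exp_add, Real.exp_log (by norm_num), Real.exp_log hr0]

lemma second_moment_bound {r m E : ℝ} (hE : 4096 ≤ E) (hEr : E ≤ r) (hm : r * E / 2 ≤ m) :
    2 / m ^ 2 * (2 * r ^ 2 + 8 * m ^ 2 / r) ≤ 24 / E := by
  have hE0 : 0 < E := by linarith
  have hr0 : 0 < r := by linarith
  have hm0 : 0 < m := lt_of_lt_of_le (by positivity) hm
  have h2 : 2 / m ^ 2 * (2 * r ^ 2 + 8 * m ^ 2 / r) = 4 * (r / m) ^ 2 + 16 / r := by
    field_simp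
    ring
  have h3 : r / m ≤ 2 / E := by
    rw [div_le_div_iff₀ hm0 hE0]; linarith
  have h4 : 2 / E ≤ 1 := by rw [div_le_one hE0]; linarith
  have h5 : (r / m) ^ 2 ≤ 2 / E := by
    have : 0 ≤ r / m := by positivity
    nlinarith
  have h6 : 16 / r ≤ 16 / E := div_le_div_of_nonneg_left (by norm_num) hE0 hEr
  have h7 : 4 * (2 / E) + 16 / E = 24 / E := by ring
  linarith

/-- The lower bound on the distance to uniformity. -/
lemma le_dgDist {row col : Fin n → ZMod q} (hn : 4 ≤ n) (hq : 2 ≤ q)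
    (hrc : ∑ i, row i = ∑ j, col j) {c : ℝ} (hc : 0 ≤ c) {t : ℕ}
    (ht : (t : ℝ) ≤ (n : ℝ) ^ 2 / (4 * (1 - Real.cos (2 * Real.pi / q))) * Real.log n
              - (n : ℝ) ^ 2 / (4 * (1 - Real.cos (2 * Real.pi / q))) * (c + 12) * Real.log q) :
    1 - (q : ℝ) ^ (-c) ≤ dgDist row col t := by
  have hn4 : (4 : ℝ) ≤ n := by exact_mod_cast hn
  have hn0 : (0 : ℝ) < n := by linarith
  have hq' : (2 : ℝ) ≤ q := by exact_mod_cast hq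
  have hx := one_sub_cos_pos hq
  have hx2 : 1 - Real.cos (2 * Real.pi / q) ≤ 2 := by
    linarith [Real.neg_one_le_cos (2 * Real.pi / q)]
  set μ := 1 - 4 * (1 - Real.cos (2 * Real.pi / q)) / (n : ℝ) ^ 2 with hμd
  have hsum := fun (hn : 4096 ≤ n) ht => sum_walkEigenvalue_cellTable_sub_le (t := t) hn hq ht hμd
  set x := 1 - Real.cos (2 * Real.pi / q) with hxd
  set l := Real.log q with hl
  set K := (c + 12) * l with hK
  have hl2 : Real.log 2 ≤ l := Real.log_le_log (by norm_num) hq'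
  have hlog2 := Real.log_two_gt_d9
  have hK2 : 12 * Real.log 2 ≤ K := by
    rw [hK]; nlinarith
  have ht2 : (t : ℝ) * (4 * x) ≤ (n : ℝ) ^ 2 * (Real.log n - K) := by
    have h1 := mul_le_mul_of_nonneg_right ht (by positivity : 0 ≤ 4 * x)
    refine h1.trans (le_of_eq ?_)
    rw [hK]; field_simp
  -- Since `t ≥ 0`, the time hypothesis forces `q ^ (c + 12) ≤ n`; so `n ≥ 2 ^ 12 = 4096`, and
  -- smaller `n` need no argument.
  have hKn : K ≤ Real.log n := by
    have h1 : 0 ≤ (n : ℝ) ^ 2 * (Real.log n - K) := le_trans (by positivity) ht2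
    have := nonneg_of_mul_nonneg_right h1 (by positivity)
    linarith
  have hexpK : Real.exp K ≤ n := by
    rw [← Real.le_log_iff_exp_le hn0]; exact hKn
  have hexp12 : Real.exp (12 * Real.log 2) = 4096 := by
    rw [show (12 : ℝ) * Real.log 2 = (12 : ℕ) * Real.log 2 by norm_num, Real.exp_nat_mul,
      Real.exp_log (by norm_num)]
    norm_num
  have h4096 : (4096 : ℝ) ≤ Real.exp K := by
    rw [← hexp12]; exact Real.exp_le_exp.2 hK2
  have hn' : (4096 : ℝ) ≤ n := h4096.trans hexpK
  have hlog0 : 0 ≤ Real.log n := Real.log_nonneg (by linarith)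
  have hsum' := hsum (by exact_mod_cast hn')
    (ht2.trans (mul_le_mul_of_nonneg_left (by linarith) (by positivity)))
  obtain ⟨hμ0, hμt⟩ := exp_div_le_one_sub_pow hn' hx hx2 (by linarith) ht2
  rw [← hμd] at hμ0 hμt
  refine le_trans ?_ (le_dgDist_of_eigenvalues hn hq hrc t hμ0
    fun p => by rw [walkEigenvalue_cellTable (by omega) p])
  set m := (n : ℝ) ^ 2 * μ ^ t with hm
  set E := Real.exp K with hE
  have hE0 : 0 < E := Real.exp_pos K
  have hmE : n * E / 2 ≤ m := by
    have := mul_le_mul_of_nonneg_left hμt (by positivity : 0 ≤ (n : ℝ) ^ 2)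
    refine le_trans (le_of_eq ?_) this
    field_simp
  have h1 : 2 / m ^ 2 * (∑ p : Fin n × Fin n, ∑ p' : Fin n × Fin n,
        walkEigenvalue (cellTable q p + -cellTable q p') ^ t - m ^ 2 + (n : ℝ) ^ 2)
      ≤ 2 / m ^ 2 * (2 * (n : ℝ) ^ 2 + 8 * m ^ 2 / n) :=
    mul_le_mul_of_nonneg_left (by linarith) (by positivity)
  have h2 := second_moment_bound h4096 hexpK hmE
  -- Here `E = q ^ (c + 12)`, and the spare `q ^ 12 ≥ 4096` absorbs the 24.
  have h3 : 24 / E ≤ (q : ℝ) ^ (-c) := by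
    have h8 : (q : ℝ) ^ (-c) = Real.exp (12 * l) / E := by
      rw [Real.rpow_def_of_pos (by linarith), hE, ← Real.exp_sub, hK]
      congr 1; ring
    rw [h8]
    refine div_le_div_of_nonneg_right ?_ hE0.le
    linarith [Real.exp_le_exp.2 (by linarith : 12 * Real.log 2 ≤ 12 * l)]
  linarith

end LowerBoundFinal

/-! ### Cutoff from the two bounds -/

section Cutoff

variable {n q : ℕ}

lemma rpow_neg_le_two_rpow_neg (hq : 2 ≤ q) {c : ℝ} (hc : 0 ≤ c) :
    (q : ℝ) ^ (-c) ≤ (2 : ℝ) ^ (-c) :=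
  Real.rpow_le_rpow_of_nonpos (by norm_num) (by exact_mod_cast hq) (by linarith)

variable [NeZero q]

lemma dgDist_nonneg {row col : Fin n → ZMod q} (t : ℕ) : 0 ≤ dgDist row col t :=
  Real.iSup_nonneg fun _ => by positivity

lemma dgDist_le_one {row col : Fin n → ZMod q} (hn : 2 ≤ n) (t : ℕ) : dgDist row col t ≤ 1 := by
  refine Real.iSup_le (fun A => ?_) zero_le_one
  set N : ℝ := (Fintype.card (ContingencyTable n q row col) : ℝ) with hN
  have hN0 : 0 < N := by rw [hN]; exact_mod_cast Fintype.card_pos_iff.2 ⟨A⟩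
  have h1 : ∑ B : ContingencyTable n q row col, |(dgTransition row col ^ t) A B - 1 / N|
      ≤ ∑ B : ContingencyTable n q row col, ((dgTransition row col ^ t) A B + 1 / N) := by
    refine Finset.sum_le_sum fun B _ => ?_
    have h2 := dgTransition_pow_nonneg t A B
    have h3 : 0 < 1 / N := by positivity
    rw [abs_le]; constructor <;> linarith
  have h4 : ∑ _B : ContingencyTable n q row col, 1 / N = 1 := by
    rw [Finset.sum_const, nsmul_eq_mul, Finset.card_univ]
    exact mul_one_div_cancel hN0.ne'
  rw [Finset.sum_add_distrib, sum_dgTransition_pow hn, h4] at h1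
  linarith

lemma exists_two_rpow_neg_lt {δ : ℝ} (hδ : 0 < δ) : ∃ c : ℝ, 0 < c ∧ (2 : ℝ) ^ (-c) < δ := by
  obtain ⟨k, hk⟩ := exists_pow_lt_of_lt_one hδ (by norm_num : (1 / 2 : ℝ) < 1)
  refine ⟨k + 1, by positivity, ?_⟩
  rw [Real.rpow_neg (by norm_num), ← Nat.cast_succ, Real.rpow_natCast, ← inv_pow, ← one_div]
  exact lt_of_le_of_lt (pow_le_pow_of_le_one (by norm_num) (by norm_num) (Nat.le_succ k)) hk

open Filter in
/-- The growth condition absorbs the error terms of both bounds. -/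
lemma eventually_log_mul_le {n q : ℕ → ℕ} (hn : Tendsto n atTop atTop)
    (ho : (fun k => Real.log (q k)) =o[atTop]
        (fun k => √(Real.log (n k)) / Real.log (Real.log (n k)))) {C : ℝ} (hC : 0 < C) :
    ∀ᶠ k in atTop, C * Real.log (Real.log (16 * n k)) * Real.log (q k) ≤ √(Real.log (n k)) := by
  have hnR : Tendsto (fun k => (n k : ℝ)) atTop atTop := tendsto_natCast_atTop_atTop.comp hn
  have h1 := ho.bound (show 0 < 1 / (2 * C) by positivity)
  filter_upwards [h1, hnR.eventually_ge_atTop (Real.exp (Real.log 16 + 3))] with k hk hnk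
  have hn0 : (0 : ℝ) < n k := lt_of_lt_of_le (Real.exp_pos _) hnk
  have hlog16 : 0 < Real.log 16 := Real.log_pos (by norm_num)
  have hlogn : Real.log 16 + 3 ≤ Real.log (n k) := (Real.le_log_iff_exp_le hn0).2 hnk
  have hll : 0 < Real.log (Real.log (n k)) := Real.log_pos (by linarith)
  -- For large `n`, `log 16 + log n ≤ (log n) ^ 2`, so passing from `n` to `16 n` costs a factor 2.
  have h16 : Real.log (Real.log (16 * n k)) ≤ 2 * Real.log (Real.log (n k)) := by
    rw [Real.log_mul (by norm_num) hn0.ne', show 2 * Real.log (Real.log (n k))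
      = Real.log (Real.log (n k) ^ 2) by rw [Real.log_pow]; norm_num]
    apply Real.log_le_log <;> nlinarith
  have hq0 : 0 ≤ Real.log (q k) := Real.log_natCast_nonneg _
  rw [Real.norm_of_nonneg hq0, Real.norm_of_nonneg (by positivity), ← mul_div_assoc,
    le_div_iff₀ hll] at hk
  calc C * Real.log (Real.log (16 * n k)) * Real.log (q k)
      ≤ C * (2 * Real.log (Real.log (n k))) * Real.log (q k) := by gcongr
    _ = 2 * C * (Real.log (q k) * Real.log (Real.log (n k))) := by ring
    _ ≤ 2 * C * (1 / (2 * C) * √(Real.log (n k))) := by gcongr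
    _ = _ := by field_simp

-- Fix `c` with `2 ^ (-c) < δ`. The growth condition eventually makes both error terms at most `ε`
-- times the cutoff time, and `640 / log log (16 n) ≤ c` holds eventually because the left side
-- tends to 0.
open Filter in
lemma hasCutoffAt_dgDist {n q : ℕ → ℕ} [∀ k, NeZero (q k)] (hn4 : ∀ k, 4 ≤ n k)
    (hq2 : ∀ k, 2 ≤ q k) (hn : Tendsto n atTop atTop)
    (ho : (fun k => Real.log (q k)) =o[atTop]
        (fun k => √(Real.log (n k)) / Real.log (Real.log (n k))))
    (row col : (k : ℕ) → Fin (n k) → ZMod (q k)) (hrc : ∀ k, ∑ i, row k i = ∑ j, col k j) :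
    HasCutoffAt (fun k => dgDist (row k) (col k))
      (fun k => (n k : ℝ) ^ 2 / (4 * (1 - Real.cos (2 * Real.pi / q k))) * Real.log (n k)) := by
  intro ε hε0 hε1
  have hnR : Tendsto (fun k => (n k : ℝ)) atTop atTop := tendsto_natCast_atTop_atTop.comp hn
  have hlogn : ∀ k, 1 ≤ Real.log (n k) := by
    intro k
    have h : (4 : ℝ) ≤ n k := by exact_mod_cast hn4 k
    rw [Real.le_log_iff_exp_le (by linarith)]
    linarith [Real.exp_one_lt_d9]
  have hsqrt : ∀ k, 1 ≤ √(Real.log (n k)) := fun k => Real.one_le_sqrt.2 (hlogn k)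
  have hsq : ∀ k, √(Real.log (n k)) * √(Real.log (n k)) = Real.log (n k) := fun k =>
    Real.mul_self_sqrt (by linarith [hlogn k])
  have hLam : Tendsto (fun k => Real.log (Real.log (16 * n k))) atTop atTop :=
    Real.tendsto_log_atTop.comp (Real.tendsto_log_atTop.comp
      (hnR.const_mul_atTop (by norm_num)))
  constructor
  · rw [Metric.tendsto_nhds]
    intro δ hδ
    obtain ⟨c, hc, hcδ⟩ := exists_two_rpow_neg_lt hδ
    filter_upwards [eventually_log_mul_le hn ho (show 0 < (c + 12) / ε by positivity),
      hLam.eventually_ge_atTop 1] with k hk hΛ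
    have hx := one_sub_cos_pos (hq2 k)
    have hq0 : 0 ≤ Real.log (q k) := Real.log_natCast_nonneg _
    have h1 : (c + 12) * Real.log (q k) ≤ ε * Real.log (n k) := by
      have h2 : (c + 12) / ε * Real.log (q k) ≤ Real.log (n k) := by
        calc _ ≤ (c + 12) / ε * Real.log (Real.log (16 * n k)) * Real.log (q k) := by
              apply mul_le_mul_of_nonneg_right _ hq0
              exact le_mul_of_one_le_right (by positivity) hΛ
          _ ≤ √(Real.log (n k)) := hk
          _ ≤ _ := by nlinarith [hsq k, hsqrt k]
      rw [div_mul_eq_mul_div, div_le_iff₀ hε0] at h2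
      linarith
    have h3 := le_dgDist (hn4 k) (hq2 k) (hrc k) hc.le (t := ⌊(1 - ε) * ((n k : ℝ) ^ 2
      / (4 * (1 - Real.cos (2 * Real.pi / q k))) * Real.log (n k))⌋₊) (by
        refine (Nat.floor_le (mul_nonneg (by linarith) (mul_nonneg (by positivity)
          (by linarith [hlogn k])))).trans ?_
        have := mul_le_mul_of_nonneg_left h1 (by positivity :
          0 ≤ (n k : ℝ) ^ 2 / (4 * (1 - Real.cos (2 * Real.pi / q k))))
        linarith)
    have h4 := rpow_neg_le_two_rpow_neg (hq2 k) hc.le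
    have h5 := dgDist_le_one (row := row k) (col := col k) (by linarith [hn4 k])
      ⌊(1 - ε) * ((n k : ℝ) ^ 2
      / (4 * (1 - Real.cos (2 * Real.pi / q k))) * Real.log (n k))⌋₊
    rw [Real.dist_eq, abs_lt]
    constructor <;> linarith
  · rw [Metric.tendsto_nhds]
    intro δ hδ
    obtain ⟨c, hc, hcδ⟩ := exists_two_rpow_neg_lt hδ
    filter_upwards [eventually_log_mul_le hn ho (show 0 < 4 * c / ε by positivity),
      hLam.eventually_ge_atTop (640 / c), hLam.eventually_ge_atTop 1] with k hk hΛ hΛ1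
    have hx := one_sub_cos_pos (hq2 k)
    have h1 : 4 * (c * Real.log (Real.log (16 * n k)) * √(Real.log (n k)) * Real.log (q k))
        ≤ ε * Real.log (n k) := by
      have h2 := mul_le_mul_of_nonneg_right hk (by linarith [hsqrt k] : 0 ≤ √(Real.log (n k)))
      rw [hsq] at h2
      have h3 := mul_le_mul_of_nonneg_left h2 hε0.le
      refine le_trans (le_of_eq ?_) h3
      field_simp
    have h3 := dgDist_le_of_le (row := row k) (col := col k) (hn4 k) (hq2 k) (c := c) (by
        rw [div_le_iff₀ (by linarith)]
        rw [div_le_iff₀ hc] at hΛ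
        linarith) (t := ⌈(1 + ε) * ((n k : ℝ) ^ 2
      / (4 * (1 - Real.cos (2 * Real.pi / q k))) * Real.log (n k))⌉₊) (by
        refine le_trans ?_ (Nat.le_ceil _)
        have := mul_le_mul_of_nonneg_left h1 (by positivity :
          0 ≤ (n k : ℝ) ^ 2 / (4 * (1 - Real.cos (2 * Real.pi / q k))))
        have h4 : (n k : ℝ) ^ 2 / (1 - Real.cos (2 * Real.pi / q k))
            = 4 * ((n k : ℝ) ^ 2 / (4 * (1 - Real.cos (2 * Real.pi / q k)))) := by
          field_simp
        rw [h4]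
        linarith)
    have h4 := rpow_neg_le_two_rpow_neg (hq2 k) hc.le
    have h5 := dgDist_nonneg (row := row k) (col := col k)
      ⌈(1 + ε) * ((n k : ℝ) ^ 2
      / (4 * (1 - Real.cos (2 * Real.pi / q k))) * Real.log (n k))⌉₊
    rw [Real.dist_eq, abs_lt]
    constructor <;> linarith

end Cutoff

theorem theorem1 :
    (∀ (n q : ℕ) [NeZero q], 4 ≤ n → 2 ≤ q →
      ∀ row col : Fin n → ZMod q, ∑ i, row i = ∑ j, col j →
        (∀ c : ℝ, 640 / Real.log (Real.log (16 * n)) ≤ c → ∀ t : ℕ,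
          (n : ℝ) ^ 2 / (4 * (1 - Real.cos (2 * Real.pi / q))) * Real.log n
              + (n : ℝ) ^ 2 / (1 - Real.cos (2 * Real.pi / q)) * c
                * Real.log (Real.log (16 * n)) * √(Real.log n) * Real.log q ≤ (t : ℝ) →
          dgDist row col t ≤ (q : ℝ) ^ (-c)) ∧
        (∀ c : ℝ, 0 ≤ c → ∀ t : ℕ,
          (t : ℝ) ≤ (n : ℝ) ^ 2 / (4 * (1 - Real.cos (2 * Real.pi / q))) * Real.log n
              - (n : ℝ) ^ 2 / (4 * (1 - Real.cos (2 * Real.pi / q))) * (c + 12) * Real.log q →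
          1 - (q : ℝ) ^ (-c) ≤ dgDist row col t)) ∧
    (∀ (n q : ℕ → ℕ) [∀ k, NeZero (q k)], (∀ k, 4 ≤ n k) → (∀ k, 2 ≤ q k) →
      Filter.Tendsto n Filter.atTop Filter.atTop →
      (fun k => Real.log (q k)) =o[Filter.atTop]
        (fun k => √(Real.log (n k)) / Real.log (Real.log (n k))) →
      ∀ row col : (k : ℕ) → Fin (n k) → ZMod (q k),
        (∀ k, ∑ i, row k i = ∑ j, col k j) →
        HasCutoffAt (fun k => dgDist (row k) (col k))
          (fun k => (n k : ℝ) ^ 2 / (4 * (1 - Real.cos (2 * Real.pi / q k)))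
            * Real.log (n k))) := by
  refine ⟨fun n q _ hn hq row col hrc => ⟨fun c hc t ht => dgDist_le_of_le hn hq hc ht,
    fun c hc t ht => le_dgDist hn hq hrc hc ht⟩, ?_⟩
  intro n q _ hn4 hq2 hn ho row col hrc
  exact hasCutoffAt_dgDist hn4 hq2 hn ho row col hrc
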